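/- Let $(\tilde M^{2m+1},\phi,\xi,\eta,\langle\cdot,\cdot\rangle)$ be a contact metric manifold, that is, $\phi^2=-I+\eta\otimes\xi$, $\eta(\xi)=1$, $\phi\xi=0$, $\eta\circ\phi=0$, $\langle X,Y\rangle=\langle\phi X,\phi Y\rangle+\eta(X)\eta(Y)$, $\langle X,\phi Y\rangle=-\langle\phi X,Y\rangle$, $\eta(X)=\langle X,\xi\rangle$ and $d\eta(X,Y)=\langle X,\phi Y\rangle$, where $d\eta(X,Y)=\frac12\big(X\eta(Y)-Y\eta(X)-\eta([X,Y])\big)$. Put $2h=\mathcal L_\xi\phi$. Suppose that $\tilde M$ is a generalized $(\kappa,\mu)$-space form with divided $R_5$: there are functions $f_1,f_2,f_3,f_4,f_{5,1},f_{5,2},f_6$ on $\tilde M$ such that the curvature tensor of $\tilde M$ is $$\tilde R=f_1R_1+f_2R_2+f_3R_3+f_4R_4+f_{5,1}R_{5,1}+f_{5,2}R_{5,2}+f_6R_6,$$ where \begin{align*} R_1(X,Y)Z&=\langle Y,Z\rangle X-\langle X,Z\rangle Y,\\ R_2(X,Y)Z&=\langle X,\phi Z\rangle\phi Y-\langle Y,\phi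 Z\rangle\phi X+2\langle X,\phi Y\rangle\phi Z,\\ R_3(X,Y)Z&=\eta(X)\eta(Z)Y-\eta(Y)\eta(Z)X+\langle X,Z\rangle\eta(Y)\xi-\langle Y,Z\rangle\eta(X)\xi,\\ R_4(X,Y)Z&=\langle Y,Z\rangle hX-\langle X,Z\rangle hY+\langle hY,Z\rangle X-\langle hX,Z\rangle Y,\\ R_{5,1}(X,Y)Z&=\langle hY,Z\rangle hX-\langle hX,Z\rangle hY,\\ R_{5,2}(X,Y)Z&=\langle\phi hY,Z\rangle\phi hX-\langle\phi hX,Z\rangle\phi hY,\\ R_6(X,Y)Z&=\eta(X)\eta(Z)hY-\eta(Y)\eta(Z)hX+\langle hX,Z\rangle\eta(Y)\xi-\langle hY,Z\rangle\eta(X)\xi. \end{align*} Let $M$ be an $n$-dimensional ($n\ge3$) C-totally real (immersed) Riemannian submanifold of $\tilde M$, i.e. $\eta$ vanishes on all tangent vectors of $M$. Let $\sigma$ be its second fundamental form, $H=\frac1n\operatorname{tr}\sigma$ its mean curvature vector, and $A_N$ the shape operators, $\langle A_NX,Y\rangle=\langle\sigma(X,Y),N\rangle$. Let $K$ be the sectional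 curvature of $M$ and $\tau=\sum_{i<j}K(e_i\wedge e_j)$ its scalar curvature ($e_1,\dots,e_n$ any orthonormal basis of $T_pM$). Let $h^T,(\phi h)^T:T_pM\to T_pM$ be the tangential parts of $h,\phi h$, and $\|Q\|^2=\sum_{i,j}\langle e_i,Qe_j\rangle^2$. For a plane $\pi\subset T_pM$ with orthonormal basis $w_1,w_2$ and $Q\in\{h,\phi h\}$ put $\operatorname{tr}(Q|_\pi)=\sum_{i=1}^{2}\langle Qw_i,w_i\rangle$ and $\det(Q|_\pi)=\det\big(\langle Qw_i,w_j\rangle\big)_{i,j=1,2}$. Then for each point $p\in M$ and each plane section $\pi\subset T_pM$, \begin{align*} \tau-K(\pi)\le{}&\frac{n^2(n-2)}{2(n-1)}\|H\|^2+\frac{(n+1)(n-2)}2f_1+f_4\{(n-1)\operatorname{tr}(h^T)-\operatorname{tr}(h|_\pi)\}\\ &+\tfrac12f_{5,1}\{(\operatorname{tr}(h^T))^2-\|h^T\|^2-2\det(h|_\pi)\}\\ &-\tfrac12f_{5,2}\{\|(\phi h)^T\|^2-(\operatorname{tr}(\phi h)^T)^2+2\det((\phi h)|_\pi)\}.\qquad(*)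 \end{align*} Equality holds in $(*)$ for $p$ and $\pi$ if and only if there are an orthonormal basis $e_1,\dots,e_n$ of $T_pM$ and an orthonormal basis $e_{n+1},\dots,e_{2m+1}$ of $T_p^\perp M$ such that $\pi=\operatorname{span}\{e_1,e_2\}$ and, in the basis $e_1,\dots,e_n$, the shape operators $A_r=A_{e_r}$ are $$A_{n+1}=\begin{pmatrix}a&0&0\\0&b&0\\0&0&(a+b)I_{n-2}\end{pmatrix},\qquad A_r=\begin{pmatrix}c_r&d_r&0\\d_r&-c_r&0\\0&0&0_{n-2}\end{pmatrix},\quad r=n+2,\dots,2m+1,$$ with real numbers $a,b,c_r,d_r$. Moreover, such bases with the additional property $e_{2m+1}=\xi$ exist if and only if equality holds in $(*)$ and $H(p)$ is orthogonal to $\xi$. -/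

import Mathlib

open Bundle Set
open scoped Manifold ContDiff Topology

noncomputable section

/-! ### Tensor calculus in a coordinate domain of a vector space `E`

A metric is a field `G` of bilinear forms, an endomorphism field is a map `E → E →L[ℝ] E`,
a vector field is a map `E → E`. -/

section Coordinates

variable {E : Type*} [NormedAddCommGroup E] [NormedSpace ℝ E]

/-- The Christoffel map `Γ_y(u, v) = ∇_u v` (for constant coordinate fields `u`, `v`) of the
Levi-Civita connection of the metric `G`: the vector determined by
`2 G(Γ(u, v), w) = (∂_u G)(v, w) + (∂_v G)(u, w) - (∂_w G)(u, v)` for all `w`. -/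
def christoffel (G : E → E →L[ℝ] E →L[ℝ] ℝ) (y u v : E) : E :=
  (G y).inverse ((1 / 2 : ℝ) •
    (fderiv ℝ G y u v + fderiv ℝ G y v u - ((fderiv ℝ G y).flip u).flip v))

/-- The curvature `R(u, v)w = ∇_u ∇_v w - ∇_v ∇_u w` (for constant coordinate fields `u`, `v`, `w`)
of the metric `G` at `y`. -/
def coordCurvature (G : E → E →L[ℝ] E →L[ℝ] ℝ) (y u v w : E) : E :=
  fderiv ℝ (fun z ↦ christoffel G z v w) y u - fderiv ℝ (fun z ↦ christoffel G z u w) y v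
    + christoffel G y u (christoffel G y v w) - christoffel G y v (christoffel G y u w)

/-- The Lie derivative `(L_ξ φ) v = [ξ, φ v] - φ [ξ, v]` of an endomorphism field `φ`. -/
def coordLieDerivEnd (ξ : E → E) (φ : E → E →L[ℝ] E) (y : E) : E →L[ℝ] E :=
  fderiv ℝ φ y (ξ y) - (fderiv ℝ ξ y).comp (φ y) + (φ y).comp (fderiv ℝ ξ y)

/-- The exterior derivative of a one-form, with the usual normalisation of contact geometry
`dη(X, Y) = (X η(Y) - Y η(X) - η([X, Y])) / 2`. -/
def coordExtDeriv (η : E → E →L[ℝ] ℝ) (y u v : E) : ℝ :=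
  (fderiv ℝ η y u v - fderiv ℝ η y v u) / 2

end Coordinates

/-! ### Riemannian manifolds -/

section Manifolds

variable {E : Type*} [NormedAddCommGroup E] [NormedSpace ℝ E]
  {M : Type*} [TopologicalSpace M] [ChartedSpace E M] [IsManifold 𝓘(ℝ, E) ∞ M]

/-- A smooth Riemannian metric on the manifold `M`. -/
abbrev SmoothMetric (E : Type*) [NormedAddCommGroup E] [NormedSpace ℝ E]
    (M : Type*) [TopologicalSpace M] [ChartedSpace E M] [IsManifold 𝓘(ℝ, E) ∞ M] : Type _ :=
  ContMDiffRiemannianMetric 𝓘(ℝ, E) ∞ E (TangentSpace 𝓘(ℝ, E) : M → Type _)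

/-- The differential at `y` of the inverse of the preferred chart at `x₀`. -/
def chartFrame (x₀ : M) (y : E) :
    E →L[ℝ] TangentSpace 𝓘(ℝ, E) ((extChartAt 𝓘(ℝ, E) x₀).symm y) :=
  mfderiv 𝓘(ℝ, E) 𝓘(ℝ, E) (extChartAt 𝓘(ℝ, E) x₀).symm y

/-- The metric in the chart at `x₀`. -/
def SmoothMetric.inChart (g : SmoothMetric E M) (x₀ : M) (y : E) : E →L[ℝ] E →L[ℝ] ℝ :=
  ContinuousLinearMap.bilinearComp (E := E) (F := E)
    (g.inner ((extChartAt 𝓘(ℝ, E) x₀).symm y)) (chartFrame x₀ y) (chartFrame x₀ y)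

/-- A one-form in the chart at `x₀`. -/
def oneFormInChart (η : ∀ x : M, TangentSpace 𝓘(ℝ, E) x →L[ℝ] ℝ) (x₀ : M) (y : E) : E →L[ℝ] ℝ :=
  (η ((extChartAt 𝓘(ℝ, E) x₀).symm y)).comp (chartFrame x₀ y)

/-- A vector field in the chart at `x₀`. -/
def vectorFieldInChart (ξ : ∀ x : M, TangentSpace 𝓘(ℝ, E) x) (x₀ : M) (y : E) : E :=
  (chartFrame x₀ y).inverse (ξ ((extChartAt 𝓘(ℝ, E) x₀).symm y))

/-- A field of endomorphisms of the tangent spaces in the chart at `x₀`. -/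
def endInChart (φ : ∀ x : M, TangentSpace 𝓘(ℝ, E) x →L[ℝ] TangentSpace 𝓘(ℝ, E) x)
    (x₀ : M) (y : E) : E →L[ℝ] E :=
  (chartFrame x₀ y).inverse.comp
    ((φ ((extChartAt 𝓘(ℝ, E) x₀).symm y)).comp (chartFrame x₀ y))

/-- The Riemann curvature tensor `R(u, v)w` at `x`, computed in the preferred chart at `x`; the
tangent space at `x` is the model space `E` by means of this very chart. -/
def SmoothMetric.curvature (g : SmoothMetric E M) (x : M)
    (u v w : TangentSpace 𝓘(ℝ, E) x) : TangentSpace 𝓘(ℝ, E) x :=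
  coordCurvature (E := E) (g.inChart x) (extChartAt 𝓘(ℝ, E) x x) u v w

/-- The sectional curvature `K(u ∧ v)` of the plane spanned by `u` and `v`. -/
def SmoothMetric.sectional (g : SmoothMetric E M) (x : M) (u v : TangentSpace 𝓘(ℝ, E) x) : ℝ :=
  g.inner x (g.curvature x u v v) u /
    (g.inner x u u * g.inner x v v - g.inner x u v ^ 2)

/-- A `g`-orthonormal family of tangent vectors at `x`. -/
def SmoothMetric.IsOrthonormal (g : SmoothMetric E M) (x : M) {ι : Type*} [DecidableEq ι]
    (e : ι → TangentSpace 𝓘(ℝ, E) x) : Prop :=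
  ∀ i j, g.inner x (e i) (e j) = if i = j then 1 else 0

/-- The scalar curvature `τ = ∑_{i < j} K(e_i ∧ e_j)`, for an orthonormal basis `e` of the tangent
space. -/
def SmoothMetric.scalar (g : SmoothMetric E M) (x : M) {n : ℕ}
    (e : Fin n → TangentSpace 𝓘(ℝ, E) x) : ℝ :=
  ∑ i, ∑ j ∈ Finset.Ioi i, g.sectional x (e i) (e j)

/-! ### Contact metric manifolds -/

variable (E M) in
/-- An almost contact metric structure `(φ, ξ, η, ⟨·,·⟩)`. -/
structure AlmostContactMetric where
  metric : SmoothMetric E M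
  phi : ∀ x : M, TangentSpace 𝓘(ℝ, E) x →L[ℝ] TangentSpace 𝓘(ℝ, E) x
  xi : ∀ x : M, TangentSpace 𝓘(ℝ, E) x
  eta : ∀ x : M, TangentSpace 𝓘(ℝ, E) x →L[ℝ] ℝ
  smooth_phi : ContMDiff 𝓘(ℝ, E) (𝓘(ℝ, E).prod 𝓘(ℝ, E →L[ℝ] E)) ∞
    (fun x ↦ TotalSpace.mk' (E →L[ℝ] E)
      (E := fun x : M ↦ TangentSpace 𝓘(ℝ, E) x →L[ℝ] TangentSpace 𝓘(ℝ, E) x) x (phi x))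
  smooth_xi : ContMDiff 𝓘(ℝ, E) 𝓘(ℝ, E).tangent ∞
    (fun x ↦ (⟨x, xi x⟩ : TangentBundle 𝓘(ℝ, E) M))
  smooth_eta : ContMDiff 𝓘(ℝ, E) (𝓘(ℝ, E).prod 𝓘(ℝ, E →L[ℝ] ℝ)) ∞
    (fun x ↦ TotalSpace.mk' (E →L[ℝ] ℝ)
      (E := fun x : M ↦ TangentSpace 𝓘(ℝ, E) x →L[ℝ] ℝ) x (eta x))
  phi_phi : ∀ x u, phi x (phi x u) = -u + eta x u • xi x
  eta_xi : ∀ x, eta x (xi x) = 1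
  phi_xi : ∀ x, phi x (xi x) = 0
  eta_phi : ∀ x u, eta x (phi x u) = 0
  inner_eq : ∀ x u v,
    metric.inner x u v = metric.inner x (phi x u) (phi x v) + eta x u * eta x v
  inner_phi : ∀ x u v, metric.inner x u (phi x v) = -metric.inner x (phi x u) v
  inner_xi : ∀ x u, metric.inner x u (xi x) = eta x u

namespace AlmostContactMetric

variable (S : AlmostContactMetric E M)

/-- The structure is a contact metric structure: `dη = Φ`, where `Φ(X, Y) = ⟨X, φ Y⟩`. The identity
is written in the coordinates of every preferred chart, on the whole chart domain. -/
def IsContact : Prop :=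
  ∀ x₀ : M, ∀ y ∈ (extChartAt 𝓘(ℝ, E) x₀).target, ∀ u v : E,
    coordExtDeriv (oneFormInChart S.eta x₀) y u v =
      S.metric.inChart x₀ y u (endInChart S.phi x₀ y v)

/-- The tensor `h`, with `2 h = L_ξ φ`, at the point `x`. -/
def h (x : M) : TangentSpace 𝓘(ℝ, E) x →L[ℝ] TangentSpace 𝓘(ℝ, E) x :=
  (1 / 2 : ℝ) • coordLieDerivEnd (vectorFieldInChart S.xi x) (endInChart S.phi x)
    (extChartAt 𝓘(ℝ, E) x x)

/-- The tensor `φ h` at the point `x`. -/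
def phiH (x : M) : TangentSpace 𝓘(ℝ, E) x →L[ℝ] TangentSpace 𝓘(ℝ, E) x :=
  (S.phi x).comp (S.h x)

section Tensors

variable (x : M) (X Y Z : TangentSpace 𝓘(ℝ, E) x)

def R₁ : TangentSpace 𝓘(ℝ, E) x :=
  S.metric.inner x Y Z • X - S.metric.inner x X Z • Y

def R₂ : TangentSpace 𝓘(ℝ, E) x :=
  S.metric.inner x X (S.phi x Z) • S.phi x Y - S.metric.inner x Y (S.phi x Z) • S.phi x X
    + (2 * S.metric.inner x X (S.phi x Y)) • S.phi x Z

def R₃ : TangentSpace 𝓘(ℝ, E) x :=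
  (S.eta x X * S.eta x Z) • Y - (S.eta x Y * S.eta x Z) • X
    + (S.metric.inner x X Z * S.eta x Y) • S.xi x - (S.metric.inner x Y Z * S.eta x X) • S.xi x

def R₄ : TangentSpace 𝓘(ℝ, E) x :=
  S.metric.inner x Y Z • S.h x X - S.metric.inner x X Z • S.h x Y
    + S.metric.inner x (S.h x Y) Z • X - S.metric.inner x (S.h x X) Z • Y

def R₅₁ : TangentSpace 𝓘(ℝ, E) x :=
  S.metric.inner x (S.h x Y) Z • S.h x X - S.metric.inner x (S.h x X) Z • S.h x Y

def R₅₂ : TangentSpace 𝓘(ℝ, E) x :=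
  S.metric.inner x (S.phiH x Y) Z • S.phiH x X - S.metric.inner x (S.phiH x X) Z • S.phiH x Y

def R₆ : TangentSpace 𝓘(ℝ, E) x :=
  (S.eta x X * S.eta x Z) • S.h x Y - (S.eta x Y * S.eta x Z) • S.h x X
    + (S.metric.inner x (S.h x X) Z * S.eta x Y) • S.xi x
    - (S.metric.inner x (S.h x Y) Z * S.eta x X) • S.xi x

end Tensors

/-- The structure is a generalized `(κ, μ)`-space form with divided `R₅` and functions
`f₁, f₂, f₃, f₄, f₅₁, f₅₂, f₆`. -/
def IsGeneralizedKappaMuDivided (f₁ f₂ f₃ f₄ f₅₁ f₅₂ f₆ : M → ℝ) : Prop :=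
  ∀ (x : M) (X Y Z : TangentSpace 𝓘(ℝ, E) x),
    S.metric.curvature x X Y Z =
      f₁ x • S.R₁ x X Y Z + f₂ x • S.R₂ x X Y Z + f₃ x • S.R₃ x X Y Z + f₄ x • S.R₄ x X Y Z
        + f₅₁ x • S.R₅₁ x X Y Z + f₅₂ x • S.R₅₂ x X Y Z + f₆ x • S.R₆ x X Y Z

end AlmostContactMetric

/-! ### Submanifolds -/

variable {E' : Type*} [NormedAddCommGroup E'] [NormedSpace ℝ E']
  {N : Type*} [TopologicalSpace N] [ChartedSpace E' N] [IsManifold 𝓘(ℝ, E') ∞ N]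

/-- `F : M → N` is a smooth isometric immersion, i.e. it makes `M` with the metric `g` an (immersed)
Riemannian submanifold of `N` with the metric `g'`. -/
structure IsIsometricImmersion (g : SmoothMetric E M) (g' : SmoothMetric E' N) (F : M → N) :
    Prop where
  smooth : ContMDiff 𝓘(ℝ, E) 𝓘(ℝ, E') ∞ F
  inner_eq : ∀ (p : M) (u v : TangentSpace 𝓘(ℝ, E) p),
    g'.inner (F p) (mfderiv 𝓘(ℝ, E) 𝓘(ℝ, E') F p u) (mfderiv 𝓘(ℝ, E) 𝓘(ℝ, E') F p v) =
      g.inner p u v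

/-- The second fundamental form at `p`, given by the Gauss formula
`σ(u, v) = ∇'_u (dF v) - dF (∇_u v)`, where `v` is extended as a constant field in the preferred
chart at `p` and `∇`, `∇'` are the Levi-Civita connections of `M` and of the ambient manifold. -/
def secondFundamentalForm (g : SmoothMetric E M) (g' : SmoothMetric E' N) (F : M → N) (p : M)
    (u v : TangentSpace 𝓘(ℝ, E) p) : TangentSpace 𝓘(ℝ, E') (F p) :=
  let f : E → E' := writtenInExtChartAt 𝓘(ℝ, E) 𝓘(ℝ, E') p F
  let y : E := extChartAt 𝓘(ℝ, E) p p
  (fderiv ℝ (fderiv ℝ f) y u v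
      + christoffel (g'.inChart (F p)) (f y) (fderiv ℝ f y u) (fderiv ℝ f y v)
      - fderiv ℝ f y (christoffel (g.inChart p) y u v) : E')

/-- The mean curvature vector: `n H = tr σ`, for an orthonormal basis `e` of the tangent space. -/
def meanCurvature (g : SmoothMetric E M) (g' : SmoothMetric E' N) (F : M → N) (p : M) {n : ℕ}
    (e : Fin n → TangentSpace 𝓘(ℝ, E) p) : TangentSpace 𝓘(ℝ, E') (F p) :=
  (1 / (n : ℝ)) • ∑ i, secondFundamentalForm g g' F p (e i) (e i)

/-- The matrix of the shape operator `A_ν` in the orthonormal basis `e`, where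
`⟨A_ν X, Y⟩ = ⟨σ(X, Y), ν⟩`. -/
def shapeMatrix (g : SmoothMetric E M) (g' : SmoothMetric E' N) (F : M → N) (p : M) {n : ℕ}
    (e : Fin n → TangentSpace 𝓘(ℝ, E) p) (ν : TangentSpace 𝓘(ℝ, E') (F p)) :
    Matrix (Fin n) (Fin n) ℝ :=
  Matrix.of fun i j ↦ g'.inner (F p) (secondFundamentalForm g g' F p (e i) (e j)) ν

/-- For an endomorphism `Q` of the ambient tangent space, the bilinear form `⟨Qᵀ u, v⟩` of the
tangential part `Qᵀ` of `Q`; it equals `⟨Q u, v⟩` because `v` is tangent to the submanifold. -/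
def tangentialForm (g' : SmoothMetric E' N) (F : M → N) (p : M)
    (Q : TangentSpace 𝓘(ℝ, E') (F p) →L[ℝ] TangentSpace 𝓘(ℝ, E') (F p))
    (u v : TangentSpace 𝓘(ℝ, E) p) : ℝ :=
  g'.inner (F p) (Q (mfderiv 𝓘(ℝ, E) 𝓘(ℝ, E') F p u)) (mfderiv 𝓘(ℝ, E) 𝓘(ℝ, E') F p v)

/-- A submanifold is C-totally real if all its tangent vectors lie in the contact distribution
`ker η`. -/
def IsCTotallyReal (S : AlmostContactMetric E' N) (F : M → N) : Prop :=
  ∀ (p : M) (u : TangentSpace 𝓘(ℝ, E) p), S.eta (F p) (mfderiv 𝓘(ℝ, E) 𝓘(ℝ, E') F p u) = 0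

end Manifolds

section LinearAlgebra

variable {V ι : Type*} [Fintype ι]

/-- The trace of a bilinear form `B(u, v) = ⟨Q u, v⟩` in an orthonormal basis: `tr Q`. -/
def frameTrace (B : V → V → ℝ) (e : ι → V) : ℝ := ∑ i, B (e i) (e i)

/-- `‖Q‖² = ∑_{i,j} ⟨e_i, Q e_j⟩²` for `B(u, v) = ⟨Q u, v⟩` and an orthonormal basis `e`. -/
def frameNormSq (B : V → V → ℝ) (e : ι → V) : ℝ := ∑ i, ∑ j, B (e j) (e i) ^ 2

/-- The determinant of `(⟨Q e_i, e_j⟩)` for `B(u, v) = ⟨Q u, v⟩` and an orthonormal basis `e`. -/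
def frameDet [DecidableEq ι] (B : V → V → ℝ) (e : ι → V) : ℝ :=
  (Matrix.of fun i j ↦ B (e i) (e j)).det

/-- The matrix `diag(a, b, a + b, …, a + b)`. -/
def blockFirst (n : ℕ) (a b : ℝ) : Matrix (Fin n) (Fin n) ℝ :=
  Matrix.diagonal fun i ↦ if (i : ℕ) = 0 then a else if (i : ℕ) = 1 then b else a + b

/-- The matrix with upper left block `[[c, d], [d, -c]]` and zeros elsewhere. -/
def blockOther (n : ℕ) (c d : ℝ) : Matrix (Fin n) (Fin n) ℝ :=
  Matrix.of fun i j ↦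
    if (i : ℕ) = 0 ∧ (j : ℕ) = 0 then c
    else if (i : ℕ) = 1 ∧ (j : ℕ) = 1 then -c
    else if (i : ℕ) = 0 ∧ (j : ℕ) = 1 ∨ (i : ℕ) = 1 ∧ (j : ℕ) = 0 then d
    else 0

end LinearAlgebra

section Chen

variable {n m : ℕ}
  {M : Type*} [TopologicalSpace M] [ChartedSpace (EuclideanSpace ℝ (Fin n)) M]
  [IsManifold (𝓡 n) ∞ M]
  {N : Type*} [TopologicalSpace N] [ChartedSpace (EuclideanSpace ℝ (Fin (2 * m + 1))) N]
  [IsManifold (𝓡 (2 * m + 1)) ∞ N]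

/-- The right-hand side of Chen's inequality at `p`, for an orthonormal basis `e` of `T_pM` and an
orthonormal basis `w` of a plane in `T_pM`. -/
def chenBound (S : AlmostContactMetric (EuclideanSpace ℝ (Fin (2 * m + 1))) N)
    (f₁ f₄ f₅₁ f₅₂ : N → ℝ) (g : SmoothMetric (EuclideanSpace ℝ (Fin n)) M) (F : M → N) (p : M)
    (e : Fin n → TangentSpace (𝓡 n) p) (w : Fin 2 → TangentSpace (𝓡 n) p) : ℝ :=
  let H := meanCurvature g S.metric F p e
  let hT := tangentialForm S.metric F p (S.h (F p))
  let phT := tangentialForm S.metric F p (S.phiH (F p))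
  (n : ℝ) ^ 2 * ((n : ℝ) - 2) / (2 * ((n : ℝ) - 1)) * S.metric.inner (F p) H H
    + ((n : ℝ) + 1) * ((n : ℝ) - 2) / 2 * f₁ (F p)
    + f₄ (F p) * (((n : ℝ) - 1) * frameTrace hT e - frameTrace hT w)
    + 1 / 2 * f₅₁ (F p) * (frameTrace hT e ^ 2 - frameNormSq hT e - 2 * frameDet hT w)
    - 1 / 2 * f₅₂ (F p) * (frameNormSq phT e - frameTrace phT e ^ 2 + 2 * frameDet phT w)

/-- `e` is an orthonormal basis of `T_pM` and `ν = (e_{n+1}, …, e_{2m+1})` is an orthonormal basis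
of the normal space such that `P = span {e₁, e₂}` and the shape operators have the block forms. -/
structure IsChenFrame (g : SmoothMetric (EuclideanSpace ℝ (Fin n)) M)
    (g' : SmoothMetric (EuclideanSpace ℝ (Fin (2 * m + 1))) N) (F : M → N) (p : M)
    (P : Submodule ℝ (TangentSpace (𝓡 n) p)) (e : Fin n → TangentSpace (𝓡 n) p)
    (ν : Fin (2 * m + 1 - n) → TangentSpace (𝓡 (2 * m + 1)) (F p)) : Prop where
  orthonormal_tangent : g.IsOrthonormal p e
  orthonormal_normal : g'.IsOrthonormal (F p) ν
  normal : ∀ r u, g'.inner (F p) (ν r) (mfderiv (𝓡 n) (𝓡 (2 * m + 1)) F p u) = 0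
  plane : Submodule.span ℝ (e '' {i | (i : ℕ) < 2}) = P
  first : ∃ a b : ℝ, ∀ r : Fin (2 * m + 1 - n), (r : ℕ) = 0 →
    shapeMatrix g g' F p e (ν r) = blockFirst n a b
  other : ∀ r : Fin (2 * m + 1 - n), (r : ℕ) ≠ 0 →
    ∃ c d : ℝ, shapeMatrix g g' F p e (ν r) = blockOther n c d

end Chen

end

/-! For orthonormal tangent vectors `u`, `v` of `M` the Gauss equation gives `K(u, v) = f₁ + f₄
(⟨hu, u⟩ + ⟨hv, v⟩) + f₅₁ · minor of h + f₅₂ · minor of φh + ⟨σ(u, u), σ(v, v)⟩ - ‖σ(u, v)‖²`. The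
terms with `f₃` and `f₆` drop out because `η` vanishes on tangent vectors. Those with `f₂` drop out
because the pullback of `η` to `M` is zero, hence so is that of `dη = Φ`, and `φ` sends tangent
vectors to normal ones. Writing the other terms as minors uses that `h` and `φh` are symmetric,
which follows from `L_ξ η = 0` and `L_ξ dη = 0`.

Summing over pairs, the `fᵢ`-terms of the right-hand side of the inequality cancel exactly. The
difference of the two sides is a quantity depending on `σ` alone
(`IsIsometricImmersion.chenBound_sub`), and it is the same for all orthonormal frames of `T_pM` and
of the plane. In a frame whose first two vectors span the plane it is a sum of squares
(`chenDefect_eq_sum`): put `c = tr σ / (n - 1)`; the `n - 1` normal vectors `σ₁₁ + σ₂₂, σ₃₃, …, σₙₙ`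
have mean `c`, and the defect is half their total squared deviation from `c` plus squares of all
off-diagonal entries except `σ₁₂`. So it is nonnegative, and it is zero iff those entries vanish and
`σᵢᵢ = σ₁₁ + σ₂₂` for `i ≥ 3`.

To pass from this vector condition to the shape operators (`exists_isChenShapeFrame`), take the
first normal along `tr σ`, or any unit normal if `tr σ = 0`, and rotate the frame of the plane until
the first shape operator is diagonal. Every other normal is orthogonal to `tr σ = (n - 1)(σ₁₁ +
σ₂₂)`, which makes its block traceless. The last normal can be `ξ` exactly when `ξ` is orthogonal to
`tr σ`. If `tr σ = 0`, the unit normal `φ(dF e₁)`, orthogonal to `ξ`, serves as first normal. -/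

noncomputable section

/-! ### Smoothness of tensor fields read in a preferred chart. -/

section ChartFrame

variable {E : Type*} [NormedAddCommGroup E] [NormedSpace ℝ E]
  {M : Type*} [TopologicalSpace M] [ChartedSpace E M] [IsManifold 𝓘(ℝ, E) ∞ M]

omit [IsManifold 𝓘(ℝ, E) ∞ M] in
theorem eventually_mem_extChartAt_target (x₀ : M) :
    ∀ᶠ y in 𝓝 (extChartAt 𝓘(ℝ, E) x₀ x₀), y ∈ (extChartAt 𝓘(ℝ, E) x₀).target :=
  extChartAt_target_mem_nhds x₀

/-- The tangent bundle is trivialised by derivatives of charts; this translates smoothness of bundle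
sections into smoothness of coordinate expressions. -/
theorem symmL_eq_chartFrame {x₀ x : M} (hx : x ∈ (extChartAt 𝓘(ℝ, E) x₀).source) (u : E) :
    ((trivializationAt E (TangentSpace 𝓘(ℝ, E)) x₀).symmL ℝ x u : E) =
      chartFrame x₀ (extChartAt 𝓘(ℝ, E) x₀ x) u := by
  have : IsManifold 𝓘(ℝ, E) 1 M := IsManifold.of_le (n := ∞) (by simp)
  rw [TangentBundle.symmL_trivializationAt (by simpa using hx)]
  simp [chartFrame, mfderivWithin_univ]
  rfl

theorem chartFrame_isInvertible {x₀ : M} {y : E} (hy : y ∈ (extChartAt 𝓘(ℝ, E) x₀).target) :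
    (chartFrame x₀ y : E →L[ℝ] E).IsInvertible := by
  have : IsManifold 𝓘(ℝ, E) 1 M := IsManifold.of_le (n := ∞) (by simp)
  have h := isInvertible_mfderivWithin_extChartAt_symm (I := 𝓘(ℝ, E)) hy
  simp only [modelWithCornersSelf_coe, range_id, mfderivWithin_univ] at h
  exact h

theorem chartFrame_inverse {x₀ : M} {y : E} (hy : y ∈ (extChartAt 𝓘(ℝ, E) x₀).target) :
    (chartFrame x₀ y : E →L[ℝ] E).inverse =
      mfderiv 𝓘(ℝ, E) 𝓘(ℝ, E) (extChartAt 𝓘(ℝ, E) x₀) ((extChartAt 𝓘(ℝ, E) x₀).symm y) := by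
  have : IsManifold 𝓘(ℝ, E) 1 M := IsManifold.of_le (n := ∞) (by simp)
  have h1 := mfderivWithin_extChartAt_symm_comp_mfderiv_extChartAt (I := 𝓘(ℝ, E)) hy
  have h2 := mfderiv_extChartAt_comp_mfderivWithin_extChartAt_symm (I := 𝓘(ℝ, E)) hy
  simp only [modelWithCornersSelf_coe, range_id, mfderivWithin_univ] at h1 h2
  exact ContinuousLinearMap.inverse_eq h1 h2

/-- The tangent space at `x₀` is identified with `E` by the preferred chart at `x₀`, so tensors at
the base point agree with their coordinate expressions there. -/
theorem chartFrame_self (x₀ : M) :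
    (chartFrame x₀ (extChartAt 𝓘(ℝ, E) x₀ x₀) : E →L[ℝ] E) = ContinuousLinearMap.id ℝ E := by
  have : IsManifold 𝓘(ℝ, E) 1 M := IsManifold.of_le (n := ∞) (by simp)
  have h := mfderivWithin_range_extChartAt_symm (I := 𝓘(ℝ, E)) (x := x₀)
  simp only [modelWithCornersSelf_coe, range_id, mfderivWithin_univ] at h
  exact h

theorem contDiffAt_comp_extChartAt_symm {V : Type*} [NormedAddCommGroup V] [NormedSpace ℝ V]
    {x₀ : M} {f : M → V} (hf : ContMDiffAt 𝓘(ℝ, E) 𝓘(ℝ, V) ∞ f x₀) :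
    ContDiffAt ℝ ∞ (fun y ↦ f ((extChartAt 𝓘(ℝ, E) x₀).symm y)) (extChartAt 𝓘(ℝ, E) x₀ x₀) := by
  have h1 : ContMDiffAt 𝓘(ℝ, E) 𝓘(ℝ, E) ∞ (extChartAt 𝓘(ℝ, E) x₀).symm
      (extChartAt 𝓘(ℝ, E) x₀ x₀) :=
    (contMDiffOn_extChartAt_symm x₀).contMDiffAt (extChartAt_target_mem_nhds x₀)
  rw [← contMDiffAt_iff_contDiffAt]
  exact ContMDiffAt.comp_of_eq (g := f) (x := extChartAt 𝓘(ℝ, E) x₀ x₀) hf h1 (by simp)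

/-- Near the base point the coordinates of the section in the hom bundle are exactly the chart
expression. The analogous results for one-forms, endomorphisms and vector fields rest on the same
comparison. -/
theorem SmoothMetric.contDiffAt_inChart (g : SmoothMetric E M) (x₀ : M) :
    ContDiffAt ℝ ∞ (g.inChart x₀) (extChartAt 𝓘(ℝ, E) x₀ x₀) := by
  have h := contDiffAt_comp_extChartAt_symm
    ((contMDiffAt_hom_bundle _).1 (g.contMDiff.contMDiffAt (x := x₀))).2
  refine h.congr_of_eventuallyEq ?_
  filter_upwards [eventually_mem_extChartAt_target x₀] with y hy
  have hs := (extChartAt 𝓘(ℝ, E) x₀).map_target hy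
  ext u v
  rw [inCoordinates_apply_eq₂ (by simpa using hs) (by simpa using hs) (Set.mem_univ _)]
  simp only [SmoothMetric.inChart]
  have := symmL_eq_chartFrame hs
  rw [(extChartAt 𝓘(ℝ, E) x₀).right_inv hy] at this
  simp only [Trivial.fiberBundle_trivializationAt', Trivial.linearMapAt_trivialization]
  have h2 : ∀ u : E, (trivializationAt E (TangentSpace 𝓘(ℝ, E)) x₀).symm
      ((extChartAt 𝓘(ℝ, E) x₀).symm y) u = chartFrame x₀ y u := fun u ↦ by
    rw [← this u, Trivialization.symmL_apply _ (by simpa using hs)]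
  rw [h2, h2]
  rfl

theorem contDiffAt_oneFormInChart {η : ∀ x : M, TangentSpace 𝓘(ℝ, E) x →L[ℝ] ℝ}
    (hη : ContMDiff 𝓘(ℝ, E) (𝓘(ℝ, E).prod 𝓘(ℝ, E →L[ℝ] ℝ)) ∞
      (fun x ↦ TotalSpace.mk' (E →L[ℝ] ℝ)
        (E := fun x : M ↦ TangentSpace 𝓘(ℝ, E) x →L[ℝ] ℝ) x (η x))) (x₀ : M) :
    ContDiffAt ℝ ∞ (oneFormInChart η x₀) (extChartAt 𝓘(ℝ, E) x₀ x₀) := by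
  have h := contDiffAt_comp_extChartAt_symm
    ((contMDiffAt_hom_bundle _).1 (hη.contMDiffAt (x := x₀))).2
  refine h.congr_of_eventuallyEq ?_
  filter_upwards [eventually_mem_extChartAt_target x₀] with y hy
  have hs := (extChartAt 𝓘(ℝ, E) x₀).map_target hy
  have := symmL_eq_chartFrame hs
  rw [(extChartAt 𝓘(ℝ, E) x₀).right_inv hy] at this
  ext u
  simp only [ContinuousLinearMap.inCoordinates, ContinuousLinearMap.comp_apply]
  rw [this]
  simp [oneFormInChart]
  rfl

theorem contDiffAt_endInChart
    {φ : ∀ x : M, TangentSpace 𝓘(ℝ, E) x →L[ℝ] TangentSpace 𝓘(ℝ, E) x}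
    (hφ : ContMDiff 𝓘(ℝ, E) (𝓘(ℝ, E).prod 𝓘(ℝ, E →L[ℝ] E)) ∞
      (fun x ↦ TotalSpace.mk' (E →L[ℝ] E)
        (E := fun x : M ↦ TangentSpace 𝓘(ℝ, E) x →L[ℝ] TangentSpace 𝓘(ℝ, E) x) x (φ x)))
    (x₀ : M) :
    ContDiffAt ℝ ∞ (endInChart φ x₀) (extChartAt 𝓘(ℝ, E) x₀ x₀) := by
  have : IsManifold 𝓘(ℝ, E) 1 M := IsManifold.of_le (n := ∞) (by simp)
  have h := contDiffAt_comp_extChartAt_symm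
    ((contMDiffAt_hom_bundle _).1 (hφ.contMDiffAt (x := x₀))).2
  refine h.congr_of_eventuallyEq ?_
  filter_upwards [eventually_mem_extChartAt_target x₀] with y hy
  have hs := (extChartAt 𝓘(ℝ, E) x₀).map_target hy
  have := symmL_eq_chartFrame hs
  rw [(extChartAt 𝓘(ℝ, E) x₀).right_inv hy] at this
  ext u
  simp only [ContinuousLinearMap.inCoordinates, ContinuousLinearMap.comp_apply]
  rw [this, TangentBundle.continuousLinearMapAt_trivializationAt (by simpa using hs)]
  simp only [endInChart]
  erw [chartFrame_inverse hy]
  rfl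

theorem contDiffAt_vectorFieldInChart {ξ : ∀ x : M, TangentSpace 𝓘(ℝ, E) x}
    (hξ : ContMDiff 𝓘(ℝ, E) 𝓘(ℝ, E).tangent ∞
      (fun x ↦ (⟨x, ξ x⟩ : TangentBundle 𝓘(ℝ, E) M))) (x₀ : M) :
    ContDiffAt ℝ ∞ (vectorFieldInChart ξ x₀) (extChartAt 𝓘(ℝ, E) x₀ x₀) := by
  have : IsManifold 𝓘(ℝ, E) 1 M := IsManifold.of_le (n := ∞) (by simp)
  have h := contDiffAt_comp_extChartAt_symm
    (contMDiffAt_section _ |>.1 (hξ.contMDiffAt (x := x₀)))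
  refine h.congr_of_eventuallyEq ?_
  filter_upwards [eventually_mem_extChartAt_target x₀] with y hy
  have hs := (extChartAt 𝓘(ℝ, E) x₀).map_target hy
  have hb : (extChartAt 𝓘(ℝ, E) x₀).symm y ∈
      (trivializationAt E (TangentSpace 𝓘(ℝ, E)) x₀).baseSet := by
    simpa using hs
  have h2 := TangentBundle.continuousLinearMapAt_trivializationAt (I := 𝓘(ℝ, E)) (𝕜 := ℝ)
    (x₀ := x₀) (x := (extChartAt 𝓘(ℝ, E) x₀).symm y) (by simpa using hs)
  have h3 := Trivialization.continuousLinearMapAt_apply_of_mem (R := ℝ)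
    (trivializationAt E (TangentSpace 𝓘(ℝ, E)) x₀) hb (ξ ((extChartAt 𝓘(ℝ, E) x₀).symm y))
  rw [← h3, h2]
  simp only [vectorFieldInChart]
  erw [chartFrame_inverse hy]

end ChartFrame

/-! ### Symmetry of `L_ξ φ` on a contact metric structure, in coordinates. -/

section ContactLinearAlgebra

variable {E : Type*} [NormedAddCommGroup E] [NormedSpace ℝ E]

/-- The algebraic relations of an almost contact metric structure on a vector space. -/
structure IsAlmostContactTuple (g : E →L[ℝ] E →L[ℝ] ℝ) (φ : E →L[ℝ] E) (ξ : E) (η : E →L[ℝ] ℝ) :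
    Prop where
  symm : ∀ u v, g u v = g v u
  phi_phi : ∀ u, φ (φ u) = -u + η u • ξ
  eta_xi : η ξ = 1
  phi_xi : φ ξ = 0
  eta_phi : ∀ u, η (φ u) = 0
  inner_eq : ∀ u v, g u v = g (φ u) (φ v) + η u * η v
  inner_phi : ∀ u v, g u (φ v) = -g (φ u) v
  inner_xi : ∀ u, g u ξ = η u

variable {G : E → E →L[ℝ] E →L[ℝ] ℝ} {φ : E → E →L[ℝ] E} {ξ : E → E} {η : E → E →L[ℝ] ℝ} {y : E}

/-- This is `L_ξ η = 0`: differentiate `η(ξ) = 1` and use `dη(ξ, u) = Φ(ξ, u) = 0`, which holds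
since `φ ξ = 0`. -/
theorem eta_fderiv_add_fderiv_eta (hξ : DifferentiableAt ℝ ξ y) (hη : DifferentiableAt ℝ η y)
    (hS : ∀ᶠ z in 𝓝 y, IsAlmostContactTuple (G z) (φ z) (ξ z) (η z))
    (hd : ∀ᶠ z in 𝓝 y, ∀ u v, coordExtDeriv η z u v = G z u (φ z v)) (u : E) :
    fderiv ℝ η y (ξ y) u + η y (fderiv ℝ ξ y u) = 0 := by
  have h1 : (fun z ↦ η z (ξ z)) =ᶠ[𝓝 y] fun _ ↦ 1 := hS.mono fun z hz ↦ hz.eta_xi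
  have h2 := congrArg (fun L : E →L[ℝ] ℝ ↦ L u) h1.fderiv_eq
  rw [fderiv_clm_apply hη hξ] at h2
  have h3 := hd.self_of_nhds (ξ y) u
  have hy := hS.self_of_nhds
  rw [hy.inner_phi, hy.phi_xi] at h3
  simp [coordExtDeriv] at h2 h3
  linarith

/-- Apply `L_ξ` to `η ∘ φ = 0` and use `L_ξ η = 0`. -/
theorem eta_coordLieDerivEnd (hφ : DifferentiableAt ℝ φ y) (hξ : DifferentiableAt ℝ ξ y)
    (hη : DifferentiableAt ℝ η y)
    (hS : ∀ᶠ z in 𝓝 y, IsAlmostContactTuple (G z) (φ z) (ξ z) (η z))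
    (hd : ∀ᶠ z in 𝓝 y, ∀ u v, coordExtDeriv η z u v = G z u (φ z v)) (u : E) :
    η y (coordLieDerivEnd ξ φ y u) = 0 := by
  have h1 : (fun z ↦ η z (φ z u)) =ᶠ[𝓝 y] fun _ ↦ 0 := hS.mono fun z hz ↦ hz.eta_phi u
  have h2 := congrArg (fun L : E →L[ℝ] ℝ ↦ L (ξ y)) h1.fderiv_eq
  rw [fderiv_clm_apply hη (hφ.clm_apply (differentiableAt_const u)),
    fderiv_clm_apply hφ (differentiableAt_const u)] at h2
  have h3 := eta_fderiv_add_fderiv_eta hξ hη hS hd (φ y u)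
  have hy := hS.self_of_nhds
  simp [coordLieDerivEnd, hy.eta_phi] at h2 ⊢
  linarith

/-- Apply `L_ξ` to `φ² = -I + η ⊗ ξ`; the right-hand side is annihilated because `L_ξ η = 0` and
`L_ξ ξ = 0`. -/
theorem coordLieDerivEnd_phi (hφ : DifferentiableAt ℝ φ y) (hξ : DifferentiableAt ℝ ξ y)
    (hη : DifferentiableAt ℝ η y)
    (hS : ∀ᶠ z in 𝓝 y, IsAlmostContactTuple (G z) (φ z) (ξ z) (η z))
    (hd : ∀ᶠ z in 𝓝 y, ∀ u v, coordExtDeriv η z u v = G z u (φ z v)) (u : E) :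
    coordLieDerivEnd ξ φ y (φ y u) = -φ y (coordLieDerivEnd ξ φ y u) := by
  have h1 : (fun z ↦ φ z (φ z u)) =ᶠ[𝓝 y] fun z ↦ -u + η z u • ξ z :=
    hS.mono fun z hz ↦ hz.phi_phi u
  have h2 := congrArg (fun L : E →L[ℝ] E ↦ L (ξ y)) h1.fderiv_eq
  have hφu := hφ.clm_apply (differentiableAt_const u)
  have hηu := hη.clm_apply (differentiableAt_const u)
  rw [fderiv_clm_apply hφ hφu, fderiv_clm_apply hφ (differentiableAt_const u),
    fderiv_const_add, fderiv_fun_smul hηu hξ, fderiv_clm_apply hη (differentiableAt_const u)] at h2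
  have h3 := eta_fderiv_add_fderiv_eta hξ hη hS hd u
  have hy := hS.self_of_nhds
  have h4 : fderiv ℝ η y (ξ y) u = - η y (fderiv ℝ ξ y u) := by linarith
  simp [h4] at h2
  simp [coordLieDerivEnd, hy.phi_phi]
  linear_combination (norm := module) h2

/-- The Lie derivative along `ξ` of the fundamental form `dη` vanishes. -/
theorem lieDeriv_fundamentalForm (hG : DifferentiableAt ℝ G y) (hφ : DifferentiableAt ℝ φ y)
    (hξ : DifferentiableAt ℝ ξ y) (hη : ContDiffAt ℝ 2 η y)
    (hS : ∀ᶠ z in 𝓝 y, IsAlmostContactTuple (G z) (φ z) (ξ z) (η z))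
    (hd : ∀ᶠ z in 𝓝 y, ∀ u v, coordExtDeriv η z u v = G z u (φ z v)) (u v : E) :
    fderiv ℝ G y (ξ y) u (φ y v) + G y u (fderiv ℝ φ y (ξ y) v) + G y (fderiv ℝ ξ y u) (φ y v)
      + G y u (φ y (fderiv ℝ ξ y v)) = 0 := by
  have hη' : DifferentiableAt ℝ (fderiv ℝ η) y :=
    (hη.fderiv_right (m := 1) (by norm_num)).differentiableAt (by norm_num)
  have hy := hS.self_of_nhds
  have hsymm : ∀ a b c, fderiv ℝ (fderiv ℝ η) y a b c = fderiv ℝ (fderiv ℝ η) y b a c := by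
    intro a b c
    have := (hη.isSymmSndFDerivAt (by simp)).eq a b
    rw [this]
  have hc (a : E) := differentiableAt_const (𝕜 := ℝ) (x := y) a
  have h1 : (fun z ↦ fderiv ℝ η z u v - fderiv ℝ η z v u) =ᶠ[𝓝 y]
      fun z ↦ 2 * G z u (φ z v) := hd.mono fun z hz ↦ by
    have := hz u v
    simp only [coordExtDeriv] at this ⊢
    linarith
  have h1' := congrArg (fun L : E →L[ℝ] ℝ ↦ L (ξ y)) h1.fderiv_eq
  have e1 (a b : E) := (hη'.clm_apply (hc a)).clm_apply (hc b)
  have e2 (a b : E) : fderiv ℝ (fun z ↦ fderiv ℝ η z a b) y =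
      ((fderiv ℝ (fderiv ℝ η) y).flip a).flip b := by
    rw [fderiv_clm_apply (hη'.clm_apply (hc a)) (hc b), fderiv_clm_apply hη' (hc a)]
    ext w; simp
  rw [fderiv_const_mul ((hG.clm_apply (hc u)).clm_apply (hφ.clm_apply (hc v))),
    fderiv_fun_sub (e1 u v) (e1 v u), e2, e2,
    fderiv_clm_apply (hG.clm_apply (hc u)) (hφ.clm_apply (hc v)), fderiv_clm_apply hG (hc u),
    fderiv_clm_apply hφ (hc v)] at h1'
  -- Cartan's formula `L_ξ dη = d(ι_ξ dη)` in coordinates: the identity `dη(ξ, b) = 0` holds near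
  -- `y` and is differentiated along `a`. Antisymmetrising in `a`, `b` and using symmetry of the
  -- second derivative of `η` leaves the derivative of `dη` along `ξ`.
  have key (a b : E) : fderiv ℝ (fderiv ℝ η) y a (ξ y) b + fderiv ℝ η y (fderiv ℝ ξ y a) b
      - fderiv ℝ (fderiv ℝ η) y a b (ξ y) - fderiv ℝ η y b (fderiv ℝ ξ y a) = 0 := by
    have h : (fun z ↦ fderiv ℝ η z (ξ z) b - fderiv ℝ η z b (ξ z)) =ᶠ[𝓝 y] fun _ ↦ 0 := by
      filter_upwards [hd, hS] with z hz hz'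
      have := hz (ξ z) b
      rw [hz'.inner_phi, hz'.phi_xi] at this
      simp [coordExtDeriv] at this
      linarith
    have h' := congrArg (fun L : E →L[ℝ] ℝ ↦ L a) h.fderiv_eq
    rw [fderiv_fun_sub ((hη'.clm_apply hξ).clm_apply (hc b)) ((hη'.clm_apply (hc b)).clm_apply hξ),
      fderiv_clm_apply (hη'.clm_apply hξ) (hc b), fderiv_clm_apply hη' hξ,
      fderiv_clm_apply (hη'.clm_apply (hc b)) hξ, fderiv_clm_apply hη' (hc b)] at h'
    simp at h'
    linarith
  have k1 := key u v
  have k2 := key v u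
  have d1 := hd.self_of_nhds (fderiv ℝ ξ y u) v
  have d2 := hd.self_of_nhds (fderiv ℝ ξ y v) u
  rw [hy.inner_phi, hy.symm] at d2
  rw [hsymm u] at k1
  rw [hsymm v, hsymm v] at k2
  simp [coordExtDeriv] at h1' d1 d2
  linarith [hy.inner_phi u (fderiv ℝ ξ y v), hy.symm (φ y u) (fderiv ℝ ξ y v),
    hy.inner_phi (fderiv ℝ ξ y v) u, hy.symm u (φ y (fderiv ℝ ξ y v))]

/-- Let `Lg = L_ξ g`, a symmetric form with `Lg(·, ξ) = L_ξ η = 0`. Since `L_ξ Φ = 0`, `Lg(a, φ b) =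
-g(a, H b)` for `H = L_ξ φ`, whence `Lg(a, b) = g(φ a, H b)`. Symmetry of `Lg` then passes to `H`,
because `H` anticommutes with `φ` and takes values in `ker η`. -/
theorem coordLieDerivEnd_symm (hG : DifferentiableAt ℝ G y) (hφ : DifferentiableAt ℝ φ y)
    (hξ : DifferentiableAt ℝ ξ y) (hη : ContDiffAt ℝ 2 η y)
    (hS : ∀ᶠ z in 𝓝 y, IsAlmostContactTuple (G z) (φ z) (ξ z) (η z))
    (hd : ∀ᶠ z in 𝓝 y, ∀ u v, coordExtDeriv η z u v = G z u (φ z v)) (u v : E) :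
    G y (coordLieDerivEnd ξ φ y u) v = G y u (coordLieDerivEnd ξ φ y v) := by
  have hη1 : DifferentiableAt ℝ η y := hη.differentiableAt (by norm_num)
  have hc (a : E) := differentiableAt_const (𝕜 := ℝ) (x := y) a
  have hy := hS.self_of_nhds
  set H := coordLieDerivEnd ξ φ y with hH
  set Lg : E → E → ℝ := fun a b ↦ fderiv ℝ G y (ξ y) a b + G y (fderiv ℝ ξ y a) b
    + G y a (fderiv ℝ ξ y b) with hLg
  have Lg_symm (a b : E) : Lg a b = Lg b a := by
    have h : (fun z ↦ G z a b) =ᶠ[𝓝 y] fun z ↦ G z b a := hS.mono fun z hz ↦ hz.symm a b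
    have h' := congrArg (fun L : E →L[ℝ] ℝ ↦ L (ξ y)) h.fderiv_eq
    rw [fderiv_clm_apply (hG.clm_apply (hc a)) (hc b), fderiv_clm_apply hG (hc a),
      fderiv_clm_apply (hG.clm_apply (hc b)) (hc a), fderiv_clm_apply hG (hc b)] at h'
    simp at h'
    simp only [hLg, h']
    rw [hy.symm (fderiv ℝ ξ y a), hy.symm a]
    ring
  have Lg_xi (a : E) : Lg a (ξ y) = 0 := by
    have h : (fun z ↦ G z a (ξ z)) =ᶠ[𝓝 y] fun z ↦ η z a := hS.mono fun z hz ↦ hz.inner_xi a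
    have h' := congrArg (fun L : E →L[ℝ] ℝ ↦ L (ξ y)) h.fderiv_eq
    rw [fderiv_clm_apply (hG.clm_apply (hc a)) hξ, fderiv_clm_apply hG (hc a),
      fderiv_clm_apply hη1 (hc a)] at h'
    have := eta_fderiv_add_fderiv_eta hξ hη1 hS hd a
    simp at h'
    simp only [hLg, hy.inner_xi]
    linarith
  have Lg_phi (a b : E) : Lg a (φ y b) + G y a (H b) = 0 := by
    have := lieDeriv_fundamentalForm hG hφ hξ hη hS hd a b
    simp [hLg, hH, coordLieDerivEnd]
    linarith
  have anti := coordLieDerivEnd_phi hφ hξ hη1 hS hd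
  have etaH := eta_coordLieDerivEnd hφ hξ hη1 hS hd
  rw [← hH] at anti etaH
  have Lg_eq (a b : E) : Lg a b = G y (φ y a) (H b) := by
    have h1 := Lg_phi a (φ y b)
    have h2 := Lg_xi a
    rw [anti, hy.phi_phi] at h1
    simp only [hLg] at h1 h2 ⊢
    simp only [map_add, map_neg, map_smul, smul_eq_mul, hy.inner_phi a] at h1
    linear_combination -h1 + η y b * h2
  -- Symmetry of `Lg` at the pair `(φ u, v)`; the extra `φ` makes `φ²` appear on one side and `g(φ
  -- v, φ (H u))`, up to sign, on the other.
  have h1 : G y (φ y (φ y u)) (H v) = G y (φ y v) (H (φ y u)) := by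
    rw [← Lg_eq, ← Lg_eq, Lg_symm]
  have h2 := hy.inner_eq v (H u)
  rw [hy.phi_phi, anti] at h1
  simp only [map_add, map_neg, map_smul, add_apply,
    neg_apply, smul_apply, smul_eq_mul, hy.symm (ξ y),
    hy.inner_xi, etaH] at h1 h2
  rw [hy.symm]
  linarith

end ContactLinearAlgebra

/-! ### Levi-Civita connection and Gauss equation in coordinates. -/

section Gauss

set_option maxSynthPendingDepth 3

variable {E : Type*} [NormedAddCommGroup E] [NormedSpace ℝ E]

/-- `G` is a twice differentiable field of nondegenerate symmetric forms near `y`. -/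
structure IsLocalMetric (G : E → E →L[ℝ] E →L[ℝ] ℝ) (y : E) : Prop where
  contDiffAt : ContDiffAt ℝ 2 G y
  symm : ∀ᶠ z in 𝓝 y, ∀ u v, G z u v = G z v u
  invertible : ∀ᶠ z in 𝓝 y, (G z).IsInvertible

variable {G : E → E →L[ℝ] E →L[ℝ] ℝ} {y : E}

theorem IsLocalMetric.eventually (hG : IsLocalMetric G y) : ∀ᶠ z in 𝓝 y, IsLocalMetric G z := by
  filter_upwards [hG.contDiffAt.eventually (by simp), hG.symm.eventually_nhds,
    hG.invertible.eventually_nhds] with z h1 h2 h3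
  exact ⟨h1, h2, h3⟩

theorem IsLocalMetric.differentiableAt (hG : IsLocalMetric G y) : DifferentiableAt ℝ G y :=
  hG.contDiffAt.differentiableAt (by norm_num)

theorem IsLocalMetric.fderiv_symm (hG : IsLocalMetric G y) (a u v : E) :
    fderiv ℝ G y a u v = fderiv ℝ G y a v u := by
  have h : (fun z ↦ G z u v) =ᶠ[𝓝 y] fun z ↦ G z v u := hG.symm.mono fun z hz ↦ hz u v
  have h' := congrArg (fun L : E →L[ℝ] ℝ ↦ L a) h.fderiv_eq
  have hc (a : E) := differentiableAt_const (𝕜 := ℝ) (x := y) a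
  have hd := hG.differentiableAt
  rw [fderiv_clm_apply (hd.clm_apply (hc u)) (hc v), fderiv_clm_apply hd (hc u),
    fderiv_clm_apply (hd.clm_apply (hc v)) (hc u), fderiv_clm_apply hd (hc v)] at h'
  simpa using h'

/-- The Koszul formula for the Christoffel map. -/
theorem IsLocalMetric.two_mul_inner_christoffel (hG : IsLocalMetric G y) (u v w : E) :
    2 * G y (christoffel G y u v) w =
      fderiv ℝ G y u v w + fderiv ℝ G y v u w - fderiv ℝ G y w u v := by
  have h : G y (christoffel G y u v) = (1 / 2 : ℝ) •
      (fderiv ℝ G y u v + fderiv ℝ G y v u - ((fderiv ℝ G y).flip u).flip v) :=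
    hG.invertible.self_of_nhds.self_apply_inverse _
  rw [h]
  simp

theorem IsLocalMetric.ext_inner (hG : IsLocalMetric G y) {u v : E}
    (h : ∀ w, G y u w = G y v w) : u = v :=
  hG.invertible.self_of_nhds.injective (ContinuousLinearMap.ext h)

theorem IsLocalMetric.christoffel_symm (hG : IsLocalMetric G y) (u v : E) :
    christoffel G y u v = christoffel G y v u := by
  refine hG.ext_inner fun w ↦ ?_
  linarith [hG.two_mul_inner_christoffel u v w, hG.two_mul_inner_christoffel v u w,
    hG.fderiv_symm w u v]

/-- The Christoffel connection is metric. -/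
theorem IsLocalMetric.fderiv_eq (hG : IsLocalMetric G y) (u v w : E) :
    fderiv ℝ G y u v w = G y (christoffel G y u v) w + G y v (christoffel G y u w) := by
  rw [hG.symm.self_of_nhds v]
  linarith [hG.two_mul_inner_christoffel u v w, hG.two_mul_inner_christoffel u w v,
    hG.fderiv_symm u v w, hG.fderiv_symm w u v, hG.fderiv_symm v u w]

/-- The Christoffel map as a bundled bilinear map. -/
def christoffelL (G : E → E →L[ℝ] E →L[ℝ] ℝ) (y : E) : E →L[ℝ] E →L[ℝ] E :=
  (ContinuousLinearMap.compL ℝ E (E →L[ℝ] ℝ) E (G y).inverse).comp ((1 / 2 : ℝ) •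
    (fderiv ℝ G y + (fderiv ℝ G y).flip -
      ((ContinuousLinearMap.flipₗᵢ ℝ E E ℝ).toContinuousLinearEquiv.toContinuousLinearMap.comp
          (fderiv ℝ G y).flip)))

theorem christoffelL_apply (u v : E) : christoffelL G y u v = christoffel G y u v := by
  simp [christoffelL, christoffel]

/-- `Γ` is built from one derivative of a `C²` field and from the inverse of `G`, and inversion is
smooth at invertible maps. Curvature needs just one derivative of `Γ`. -/
theorem IsLocalMetric.differentiableAt_christoffelL [CompleteSpace E] (hG : IsLocalMetric G y) :
    DifferentiableAt ℝ (christoffelL G) y := by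
  have hG' : DifferentiableAt ℝ (fderiv ℝ G) y :=
    (hG.contDiffAt.fderiv_right (m := 1) (by norm_num)).differentiableAt (by norm_num)
  have hinv : DifferentiableAt ℝ (fun z ↦ (G z).inverse) y :=
    ((hG.invertible.self_of_nhds.contDiffAt_map_inverse (n := 1)).differentiableAt
      (by norm_num)).comp y hG.differentiableAt
  have hfl : DifferentiableAt ℝ (fun z ↦ (fderiv ℝ G z).flip) y :=
    (ContinuousLinearMap.flipₗᵢ ℝ E E (E →L[ℝ] ℝ)).toContinuousLinearEquiv
      |>.differentiableAt.comp y hG'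
  unfold christoffelL
  have hK := (hG'.fun_add hfl).fun_sub ((differentiableAt_const (𝕜 := ℝ) (x := y)
    (ContinuousLinearMap.flipₗᵢ ℝ E E ℝ).toContinuousLinearEquiv.toContinuousLinearMap).clm_comp
      hfl)
  have hL : DifferentiableAt ℝ
      (fun z ↦ ContinuousLinearMap.compL ℝ E (E →L[ℝ] ℝ) E (G z).inverse) y :=
    (ContinuousLinearMap.compL ℝ E (E →L[ℝ] ℝ) E).differentiableAt.comp y hinv
  exact hL.clm_comp (hK.fun_const_smul (1 / 2 : ℝ))

/-- With `Γ` bundled as a bilinear field, the product rule also covers `Γ` evaluated at varying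
arguments, as the Gauss equation requires. -/
theorem coordCurvature_eq [CompleteSpace E] (hG : IsLocalMetric G y) (u v w : E) :
    coordCurvature G y u v w =
      fderiv ℝ (christoffelL G) y u v w - fderiv ℝ (christoffelL G) y v u w
        + christoffelL G y u (christoffelL G y v w)
        - christoffelL G y v (christoffelL G y u w) := by
  have hd := hG.differentiableAt_christoffelL
  have hc (a : E) := differentiableAt_const (𝕜 := ℝ) (x := y) a
  have h (a b c : E) : fderiv ℝ (fun z ↦ christoffel G z a b) y c =
      fderiv ℝ (christoffelL G) y c a b := by
    simp only [← christoffelL_apply]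
    rw [fderiv_clm_apply (hd.clm_apply (hc a)) (hc b), fderiv_clm_apply hd (hc a)]
    simp
  rw [coordCurvature, h, h]
  simp only [christoffelL_apply]

variable {E' : Type*} [NormedAddCommGroup E'] [NormedSpace ℝ E']
  {G' : E' → E' →L[ℝ] E' →L[ℝ] ℝ} {f : E → E'}

/-- The second fundamental form of the map `f` in coordinates. -/
def coordSecondForm (G : E → E →L[ℝ] E →L[ℝ] ℝ) (G' : E' → E' →L[ℝ] E' →L[ℝ] ℝ) (f : E → E')
    (y u v : E) : E' :=
  fderiv ℝ (fderiv ℝ f) y u v + christoffel G' (f y) (fderiv ℝ f y u) (fderiv ℝ f y v)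
    - fderiv ℝ f y (christoffel G y u v)

theorem ContDiffAt.fderiv_fderiv_symm (hf : ContDiffAt ℝ 2 f y) (u v : E) :
    fderiv ℝ (fderiv ℝ f) y u v = fderiv ℝ (fderiv ℝ f) y v u :=
  (hf.isSymmSndFDerivAt (by simp)).eq u v

theorem coordSecondForm_symm (hG : IsLocalMetric G y) (hG' : IsLocalMetric G' (f y))
    (hf : ContDiffAt ℝ 2 f y) (u v : E) :
    coordSecondForm G G' f y u v = coordSecondForm G G' f y v u := by
  simp only [coordSecondForm, hf.fderiv_fderiv_symm u v, hG.christoffel_symm u v,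
    hG'.christoffel_symm (fderiv ℝ f y u)]

/-- The second fundamental form of an isometric immersion is normal. -/
theorem inner_coordSecondForm_tangent (hG : IsLocalMetric G y) (hG' : IsLocalMetric G' (f y))
    (hf : ContDiffAt ℝ 2 f y)
    (hi : ∀ᶠ z in 𝓝 y, ∀ u v, G z u v = G' (f z) (fderiv ℝ f z u) (fderiv ℝ f z v)) (u v w : E) :
    G' (f y) (coordSecondForm G G' f y u v) (fderiv ℝ f y w) = 0 := by
  have hf' : DifferentiableAt ℝ (fderiv ℝ f) y :=
    (hf.fderiv_right (m := 1) (by norm_num)).differentiableAt (by norm_num)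
  have hf0 : DifferentiableAt ℝ f y := hf.differentiableAt (by norm_num)
  have hc (a : E) := differentiableAt_const (𝕜 := ℝ) (x := y) a
  have hGf : DifferentiableAt ℝ (fun z ↦ G' (f z)) y := hG'.differentiableAt.comp y hf0
  -- Derivative of the isometry condition. Substituted into the Koszul formula of `G`, it turns that
  -- formula into the one of `G'` plus second derivatives of `f`, most of which cancel by symmetry.
  have key (a b c : E) : fderiv ℝ G y a b c =
      fderiv ℝ G' (f y) (fderiv ℝ f y a) (fderiv ℝ f y b) (fderiv ℝ f y c)
        + G' (f y) (fderiv ℝ (fderiv ℝ f) y a b) (fderiv ℝ f y c)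
        + G' (f y) (fderiv ℝ f y b) (fderiv ℝ (fderiv ℝ f) y a c) := by
    have h : (fun z ↦ G z b c) =ᶠ[𝓝 y] fun z ↦ G' (f z) (fderiv ℝ f z b) (fderiv ℝ f z c) :=
      hi.mono fun z hz ↦ hz b c
    have h' := congrArg (fun L : E →L[ℝ] ℝ ↦ L a) h.fderiv_eq
    have hd := hG.differentiableAt
    have hcomp : fderiv ℝ (fun z ↦ G' (f z)) y = (fderiv ℝ G' (f y)).comp (fderiv ℝ f y) :=
      fderiv_comp y hG'.differentiableAt hf0
    rw [fderiv_clm_apply (hd.clm_apply (hc b)) (hc c), fderiv_clm_apply hd (hc b),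
      fderiv_clm_apply (hGf.clm_apply (hf'.clm_apply (hc b))) (hf'.clm_apply (hc c)),
      fderiv_clm_apply hGf (hf'.clm_apply (hc b)), fderiv_clm_apply hf' (hc b),
      fderiv_clm_apply hf' (hc c), hcomp] at h'
    simp at h'
    linarith
  have e1 := hi.self_of_nhds (christoffel G y u v) w
  have e2 := hG.two_mul_inner_christoffel u v w
  have e3 := hG'.two_mul_inner_christoffel (fderiv ℝ f y u) (fderiv ℝ f y v) (fderiv ℝ f y w)
  rw [key, key, key] at e2
  have s := hG'.symm.self_of_nhds
  simp only [coordSecondForm, map_add, map_sub, add_apply, sub_apply, ← e1]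
  rw [hf.fderiv_fderiv_symm w u, hf.fderiv_fderiv_symm w v, hf.fderiv_fderiv_symm v u,
    s (fderiv ℝ f y v) (fderiv ℝ (fderiv ℝ f) y u w),
    s (fderiv ℝ f y u) (fderiv ℝ (fderiv ℝ f) y v w)] at e2
  linarith

/-- The Gauss equation. -/
theorem gauss_equation [CompleteSpace E] [CompleteSpace E'] (hG : IsLocalMetric G y)
    (hG' : IsLocalMetric G' (f y)) (hf : ContDiffAt ℝ 3 f y)
    (hi : ∀ᶠ z in 𝓝 y, ∀ u v, G z u v = G' (f z) (fderiv ℝ f z u) (fderiv ℝ f z v))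
    (u v w z : E) :
    G y (coordCurvature G y u v w) z =
      G' (f y) (coordCurvature G' (f y) (fderiv ℝ f y u) (fderiv ℝ f y v) (fderiv ℝ f y w))
          (fderiv ℝ f y z)
        + G' (f y) (coordSecondForm G G' f y v w) (coordSecondForm G G' f y u z)
        - G' (f y) (coordSecondForm G G' f y u w) (coordSecondForm G G' f y v z) := by
  have hf2 : ContDiffAt ℝ 2 f y := hf.of_le (by norm_num)
  have hf' : ContDiffAt ℝ 2 (fderiv ℝ f) y := hf.fderiv_right (by norm_num)
  have hd0 : DifferentiableAt ℝ f y := hf.differentiableAt (by norm_num)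
  have hd1 : DifferentiableAt ℝ (fderiv ℝ f) y := hf'.differentiableAt (by norm_num)
  have hd2 : DifferentiableAt ℝ (fderiv ℝ (fderiv ℝ f)) y :=
    (hf'.fderiv_right (m := 1) (by norm_num)).differentiableAt (by norm_num)
  have hΓ := hG.differentiableAt_christoffelL
  have hΓ' := hG'.differentiableAt_christoffelL
  have hc (a : E) := differentiableAt_const (𝕜 := ℝ) (x := y) a
  have hGf : DifferentiableAt ℝ (fun z ↦ G' (f z)) y := hG'.differentiableAt.comp y hd0
  have hΓf : DifferentiableAt ℝ (fun z ↦ christoffelL G' (f z)) y := hΓ'.comp y hd0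
  have hcomp : fderiv ℝ (fun z ↦ G' (f z)) y = (fderiv ℝ G' (f y)).comp (fderiv ℝ f y) :=
    fderiv_comp y hG'.differentiableAt hd0
  have hcompΓ : fderiv ℝ (fun z ↦ christoffelL G' (f z)) y =
      (fderiv ℝ (christoffelL G') (f y)).comp (fderiv ℝ f y) := fderiv_comp y hΓ' hd0
  have hσ (a b : E) : (fun z ↦ coordSecondForm G G' f z a b) = fun z ↦
      fderiv ℝ (fderiv ℝ f) z a b + christoffelL G' (f z) (fderiv ℝ f z a) (fderiv ℝ f z b)
        - fderiv ℝ f z (christoffelL G z a b) := by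
    simp only [christoffelL_apply, coordSecondForm]
  have t1 (a b : E) := (hd2.clm_apply (hc a)).clm_apply (hc b)
  have t2 (a b : E) := (hΓf.clm_apply (hd1.clm_apply (hc a))).clm_apply (hd1.clm_apply (hc b))
  have t3 (a b : E) := hd1.clm_apply ((hΓ.clm_apply (hc a)).clm_apply (hc b))
  have hσd (a b : E) : DifferentiableAt ℝ (fun z ↦ coordSecondForm G G' f z a b) y := by
    rw [hσ]
    exact ((t1 a b).add (t2 a b)).sub (t3 a b)
  have hDσ (a b c : E) : fderiv ℝ (fun z ↦ coordSecondForm G G' f z b c) y a =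
      fderiv ℝ (fderiv ℝ (fderiv ℝ f)) y a b c
        + fderiv ℝ (christoffelL G') (f y) (fderiv ℝ f y a) (fderiv ℝ f y b) (fderiv ℝ f y c)
        + christoffel G' (f y) (fderiv ℝ (fderiv ℝ f) y a b) (fderiv ℝ f y c)
        + christoffel G' (f y) (fderiv ℝ f y b) (fderiv ℝ (fderiv ℝ f) y a c)
        - fderiv ℝ (fderiv ℝ f) y a (christoffel G y b c)
        - fderiv ℝ f y (fderiv ℝ (christoffelL G) y a b c) := by
    rw [hσ, fderiv_fun_sub ((t1 b c).fun_add (t2 b c)) (t3 b c), fderiv_fun_add (t1 b c) (t2 b c),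
      fderiv_clm_apply (hd2.clm_apply (hc b)) (hc c), fderiv_clm_apply hd2 (hc b),
      fderiv_clm_apply (hΓf.clm_apply (hd1.clm_apply (hc b))) (hd1.clm_apply (hc c)),
      fderiv_clm_apply hΓf (hd1.clm_apply (hc b)), fderiv_clm_apply hd1 (hc b),
      fderiv_clm_apply hd1 (hc c), fderiv_clm_apply hd1 ((hΓ.clm_apply (hc b)).clm_apply (hc c)),
      fderiv_clm_apply (hΓ.clm_apply (hc b)) (hc c), fderiv_clm_apply hΓ (hc b), hcompΓ]
    simp [christoffelL_apply]
    abel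
  -- Normality of the second fundamental form is needed on a neighbourhood, since it is
  -- differentiated next.
  have hnorm : ∀ᶠ z in 𝓝 y, ∀ a b c,
      G' (f z) (coordSecondForm G G' f z a b) (fderiv ℝ f z c) = 0 := by
    filter_upwards [hG.eventually, hd0.continuousAt.eventually hG'.eventually,
      hf2.eventually (by simp), hi.eventually_nhds] with z h1 h2 h3 h4
    exact inner_coordSecondForm_tangent h1 h2 h3 h4
  have s := hG'.symm.self_of_nhds
  -- the Weingarten equation
  have wein (a b c d : E) :
      G' (f y) (fderiv ℝ (fun z ↦ coordSecondForm G G' f z b c) y a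
        + christoffel G' (f y) (fderiv ℝ f y a) (coordSecondForm G G' f y b c)) (fderiv ℝ f y d) =
      - G' (f y) (coordSecondForm G G' f y b c) (coordSecondForm G G' f y a d) := by
    have h : (fun z ↦ G' (f z) (coordSecondForm G G' f z b c) (fderiv ℝ f z d)) =ᶠ[𝓝 y]
        fun _ ↦ 0 := hnorm.mono fun z hz ↦ hz b c d
    have h' := congrArg (fun L : E →L[ℝ] ℝ ↦ L a) h.fderiv_eq
    rw [fderiv_clm_apply (hGf.clm_apply (hσd b c)) (hd1.clm_apply (hc d)),
      fderiv_clm_apply hGf (hσd b c), fderiv_clm_apply hd1 (hc d), hcomp] at h'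
    have h2 := hnorm.self_of_nhds b c (christoffel G y a d)
    have h3 := hG'.fderiv_eq (fderiv ℝ f y a) (coordSecondForm G G' f y b c) (fderiv ℝ f y d)
    have h4 : G' (f y) (coordSecondForm G G' f y b c) (coordSecondForm G G' f y a d) =
      G' (f y) (coordSecondForm G G' f y b c) (fderiv ℝ (fderiv ℝ f) y a d)
      + G' (f y) (coordSecondForm G G' f y b c)
        (christoffel G' (f y) (fderiv ℝ f y a) (fderiv ℝ f y d))
      - G' (f y) (coordSecondForm G G' f y b c) (fderiv ℝ f y (christoffel G y a d)) := by
      rw [← map_add, ← map_sub]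
      rfl
    simp at h'
    rw [h4, map_add, add_apply]
    linarith
  have w1 := wein u v w z
  have w2 := wein v u w z
  have hΓ'lin (a b c : E') : christoffel G' (f y) a (b - c) =
      christoffel G' (f y) a b - christoffel G' (f y) a c := by
    simp only [← christoffelL_apply, map_sub]
  have hΓ'add (a b c : E') : christoffel G' (f y) a (b + c) =
      christoffel G' (f y) a b + christoffel G' (f y) a c := by
    simp only [← christoffelL_apply, map_add]
  have n1 := hnorm.self_of_nhds u (christoffel G y v w) z
  have n2 := hnorm.self_of_nhds v (christoffel G y u w) z
  have i1 := hi.self_of_nhds (coordCurvature G y u v w) z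
  -- Antisymmetrised covariant derivative of `σ`: third derivatives of `f` cancel by symmetry and
  -- the derivatives of the Christoffel maps assemble into the two curvatures. The two remaining `σ`
  -- terms are normal and vanish when paired with a tangent vector.
  have hsub : fderiv ℝ (fun z ↦ coordSecondForm G G' f z v w) y u
        + christoffel G' (f y) (fderiv ℝ f y u) (coordSecondForm G G' f y v w)
      - (fderiv ℝ (fun z ↦ coordSecondForm G G' f z u w) y v
        + christoffel G' (f y) (fderiv ℝ f y v) (coordSecondForm G G' f y u w)) =
      coordCurvature G' (f y) (fderiv ℝ f y u) (fderiv ℝ f y v) (fderiv ℝ f y w)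
        - fderiv ℝ f y (coordCurvature G y u v w)
        - coordSecondForm G G' f y u (christoffel G y v w)
        + coordSecondForm G G' f y v (christoffel G y u w) := by
    rw [hDσ, hDσ, coordCurvature_eq hG, coordCurvature_eq hG', hf'.fderiv_fderiv_symm u v,
      hf2.fderiv_fderiv_symm u v]
    simp only [coordSecondForm, hΓ'lin, hΓ'add, map_sub, map_add, christoffelL_apply]
    abel
  have h5 := congrArg (fun L : E' ↦ G' (f y) L (fderiv ℝ f y z)) hsub
  simp only [map_sub, sub_apply, w1, w2] at h5
  simp only [map_sub, map_add, sub_apply, add_apply, n1, n2, ← i1] at h5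
  linarith

end Gauss

/-! ### The defect as a sum of squares. -/

section ChenAlgebra

open scoped RealInnerProductSpace

variable {V : Type*} [NormedAddCommGroup V] [InnerProductSpace ℝ V]
  {X : Type*} [NormedAddCommGroup X] [InnerProductSpace ℝ X]
  {ι κ : Type*} [Fintype ι] [Fintype κ]

theorem Orthonormal.sum_inner_smul_of_mem_span {w : ι → V} (hw : Orthonormal ℝ w) {v : V}
    (hv : v ∈ Submodule.span ℝ (range w)) : ∑ i, ⟪w i, v⟫ • w i = v := by
  obtain ⟨c, rfl⟩ := (Submodule.mem_span_range_iff_exists_fun ℝ).1 hv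
  exact Finset.sum_congr rfl fun i _ ↦ by rw [hw.inner_right_fintype]

/-- The trace of a bilinear map in an orthonormal frame depends only on the span of the frame. -/
theorem Orthonormal.sum_bilin_eq {Y : Type*} [AddCommGroup Y] [Module ℝ Y]
    (B : V →ₗ[ℝ] V →ₗ[ℝ] Y) {w : ι → V} {w' : κ → V} (hw : Orthonormal ℝ w)
    (hw' : Orthonormal ℝ w') (h : Submodule.span ℝ (range w) = Submodule.span ℝ (range w')) :
    ∑ i, B (w i) (w i) = ∑ j, B (w' j) (w' j) := by
  have h1 (i : ι) : ∑ j, ⟪w' j, w i⟫ • w' j = w i :=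
    hw'.sum_inner_smul_of_mem_span (h ▸ Submodule.subset_span (mem_range_self i))
  have h2 (j : κ) : ∑ i, ⟪w i, w' j⟫ • w i = w' j :=
    hw.sum_inner_smul_of_mem_span (h ▸ Submodule.subset_span (mem_range_self j))
  calc ∑ i, B (w i) (w i) = ∑ i, B (w i) (∑ j, ⟪w' j, w i⟫ • w' j) := by simp only [h1]
    _ = ∑ j, B (∑ i, ⟪w i, w' j⟫ • w i) (w' j) := by
      simp only [map_sum, map_smul, LinearMap.sum_apply, LinearMap.smul_apply]
      rw [Finset.sum_comm]
      exact Finset.sum_congr rfl fun j _ ↦ Finset.sum_congr rfl fun i _ ↦ by rw [real_inner_comm]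
    _ = ∑ j, B (w' j) (w' j) := by simp only [h2]

/-- The trace of a vector valued bilinear map in a frame. -/
def frameSum (σ : V →ₗ[ℝ] V →ₗ[ℝ] X) (e : ι → V) : X := ∑ i, σ (e i) (e i)

/-- The squared norm of a vector valued bilinear map in a frame. -/
def frameSqSum (σ : V →ₗ[ℝ] V →ₗ[ℝ] X) (e : ι → V) : ℝ :=
  ∑ i, ∑ j, ⟪σ (e i) (e j), σ (e i) (e j)⟫

theorem frameSum_eq (σ : V →ₗ[ℝ] V →ₗ[ℝ] X) {w : ι → V} {w' : κ → V} (hw : Orthonormal ℝ w)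
    (hw' : Orthonormal ℝ w') (h : Submodule.span ℝ (range w) = Submodule.span ℝ (range w')) :
    frameSum σ w = frameSum σ w' :=
  hw.sum_bilin_eq σ hw' h

/-- A double trace: invariance of the trace is applied in one argument with the other frozen, then
in the other. -/
theorem frameSqSum_eq (σ : V →ₗ[ℝ] V →ₗ[ℝ] X) {w : ι → V} {w' : κ → V} (hw : Orthonormal ℝ w)
    (hw' : Orthonormal ℝ w') (h : Submodule.span ℝ (range w) = Submodule.span ℝ (range w')) :
    frameSqSum σ w = frameSqSum σ w' := by
  have h1 (v : V) := hw.sum_bilin_eq ((innerₗ X).compl₁₂ (σ v) (σ v)) hw' h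
  have h2 (v : V) := hw.sum_bilin_eq ((innerₗ X).compl₁₂ (σ.flip v) (σ.flip v)) hw' h
  simp only [LinearMap.compl₁₂_apply, innerₗ_apply_apply, LinearMap.flip_apply] at h1 h2
  unfold frameSqSum
  simp only [h1]
  rw [Finset.sum_comm]
  simp only [h2]
  exact Finset.sum_comm

/-- The difference of the two sides of Chen's inequality. -/
def chenDefect {n : ℕ} (σ : V →ₗ[ℝ] V →ₗ[ℝ] X) (e : Fin n → V) (w : Fin 2 → V) : ℝ :=
  ((n : ℝ) - 2) / (2 * ((n : ℝ) - 1)) * ⟪frameSum σ e, frameSum σ e⟫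
    - (⟪frameSum σ e, frameSum σ e⟫ - frameSqSum σ e) / 2
    + (⟪frameSum σ w, frameSum σ w⟫ - frameSqSum σ w) / 2

/-- Allows both frames to be replaced by an orthonormal basis whose first two vectors span the
plane. -/
theorem chenDefect_eq {n : ℕ} (σ : V →ₗ[ℝ] V →ₗ[ℝ] X) {e e' : Fin n → V} {w w' : Fin 2 → V}
    (he : Orthonormal ℝ e) (he' : Orthonormal ℝ e') (hw : Orthonormal ℝ w)
    (hw' : Orthonormal ℝ w')
    (hee : Submodule.span ℝ (range e) = Submodule.span ℝ (range e'))
    (hww : Submodule.span ℝ (range w) = Submodule.span ℝ (range w')) :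
    chenDefect σ e w = chenDefect σ e' w' := by
  simp only [chenDefect, frameSum_eq σ he he' hee, frameSqSum_eq σ he he' hee,
    frameSum_eq σ hw hw' hww, frameSqSum_eq σ hw hw' hww]

/-- The shape of a second fundamental form with equality in Chen's inequality. -/
structure IsChenBlock {k : ℕ} (σ : V →ₗ[ℝ] V →ₗ[ℝ] X) (e : Fin (k + 2) → V) : Prop where
  zero : ∀ i : Fin k, σ (e 0) (e i.succ.succ) = 0
  one : ∀ i : Fin k, σ (e 1) (e i.succ.succ) = 0
  off : ∀ i j : Fin k, i ≠ j → σ (e i.succ.succ) (e j.succ.succ) = 0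
  diag : ∀ i : Fin k, σ (e i.succ.succ) (e i.succ.succ) = σ (e 0) (e 0) + σ (e 1) (e 1)

theorem frameSum_succ_succ {k : ℕ} (σ : V →ₗ[ℝ] V →ₗ[ℝ] X) (e : Fin (k + 2) → V) :
    frameSum σ e = σ (e 0) (e 0) + σ (e 1) (e 1) +
      ∑ i : Fin k, σ (e i.succ.succ) (e i.succ.succ) := by
  simp [frameSum, Fin.sum_univ_succ, add_assoc]

/-- Here `n = k + 2`. The `k + 1` vectors `σ₀₀ + σ₁₁` and `σᵢᵢ` (`i ≥ 2`) add up to `tr σ`, so their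
mean is `c`, and the variance identity turns their squared norms minus `‖tr σ‖² / (k + 1)` into
squared deviations. Subtracting the plane's own contribution removes `σ₀₁` altogether. No
orthonormality of `e` is involved. -/
theorem chenDefect_eq_sum {k : ℕ} {σ : V →ₗ[ℝ] V →ₗ[ℝ] X} (hσ : ∀ u v, σ u v = σ v u)
    (e : Fin (k + 2) → V) (c : X) (hc : c = ((k : ℝ) + 1)⁻¹ • frameSum σ e) :
    chenDefect σ e ![e 0, e 1] =
      (‖σ (e 0) (e 0) + σ (e 1) (e 1) - c‖ ^ 2
        + ∑ i : Fin k, ‖σ (e i.succ.succ) (e i.succ.succ) - c‖ ^ 2) / 2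
      + ∑ i : Fin k, ‖σ (e 0) (e i.succ.succ)‖ ^ 2
      + ∑ i : Fin k, ‖σ (e 1) (e i.succ.succ)‖ ^ 2
      + (∑ i : Fin k, ∑ j : Fin k,
          if i = j then 0 else ‖σ (e i.succ.succ) (e j.succ.succ)‖ ^ 2) / 2 := by
  have hk : (k : ℝ) + 1 ≠ 0 := by positivity
  have hT : frameSum σ e = ((k : ℝ) + 1) • c := by rw [hc, smul_inv_smul₀ hk]
  have h1 : ∑ i : Fin k, σ (e i.succ.succ) (e i.succ.succ) =
      ((k : ℝ) + 1) • c - (σ (e 0) (e 0) + σ (e 1) (e 1)) := by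
    rw [← hT, frameSum_succ_succ]
    abel
  have h2 : ∑ i : Fin k, ⟪σ (e i.succ.succ) (e i.succ.succ), c⟫ =
      ((k : ℝ) + 1) * ⟪c, c⟫ - ⟪σ (e 0) (e 0), c⟫ - ⟪σ (e 1) (e 1), c⟫ := by
    rw [← sum_inner, h1, inner_sub_left, inner_add_left, inner_smul_left]
    simp
    ring
  have h3 : ∑ i : Fin k, ∑ j : Fin k,
        ⟪σ (e i.succ.succ) (e j.succ.succ), σ (e i.succ.succ) (e j.succ.succ)⟫ =
      ∑ i : Fin k, ⟪σ (e i.succ.succ) (e i.succ.succ), σ (e i.succ.succ) (e i.succ.succ)⟫ +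
      ∑ i : Fin k, ∑ j : Fin k,
        if i = j then 0 else
          ⟪σ (e i.succ.succ) (e j.succ.succ), σ (e i.succ.succ) (e j.succ.succ)⟫ := by
    rw [← Finset.sum_add_distrib]
    refine Finset.sum_congr rfl fun i _ ↦ ?_
    have : ∀ j : Fin k,
        ⟪σ (e i.succ.succ) (e j.succ.succ), σ (e i.succ.succ) (e j.succ.succ)⟫ =
        (if i = j then ⟪σ (e i.succ.succ) (e i.succ.succ), σ (e i.succ.succ) (e i.succ.succ)⟫
          else 0) + if i = j then 0 else
          ⟪σ (e i.succ.succ) (e j.succ.succ), σ (e i.succ.succ) (e j.succ.succ)⟫ := by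
      intro j
      by_cases h : i = j
      · subst h; simp
      · simp [h]
    rw [Finset.sum_congr rfl fun j _ ↦ this j, Finset.sum_add_distrib]
    simp
  have h4 : frameSqSum σ e = ⟪σ (e 0) (e 0), σ (e 0) (e 0)⟫ + ⟪σ (e 1) (e 1), σ (e 1) (e 1)⟫
      + 2 * ⟪σ (e 0) (e 1), σ (e 0) (e 1)⟫
      + 2 * ∑ i : Fin k, ⟪σ (e 0) (e i.succ.succ), σ (e 0) (e i.succ.succ)⟫
      + 2 * ∑ i : Fin k, ⟪σ (e 1) (e i.succ.succ), σ (e 1) (e i.succ.succ)⟫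
      + ∑ i : Fin k, ∑ j : Fin k,
        ⟪σ (e i.succ.succ) (e j.succ.succ), σ (e i.succ.succ) (e j.succ.succ)⟫ := by
    have hs (i : Fin k) (j) : σ (e i.succ.succ) (e j) = σ (e j) (e i.succ.succ) := hσ _ _
    simp only [frameSqSum, Fin.sum_univ_succ, Finset.sum_add_distrib, Fin.succ_zero_eq_one,
      hs _ 0, hs _ 1, hσ (e 1) (e 0)]
    ring
  have h5 : frameSum σ ![e 0, e 1] = σ (e 0) (e 0) + σ (e 1) (e 1) := by
    simp [frameSum, Fin.sum_univ_two]
  have h6 : frameSqSum σ ![e 0, e 1] =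
      ⟪σ (e 0) (e 0), σ (e 0) (e 0)⟫ + ⟪σ (e 1) (e 1), σ (e 1) (e 1)⟫
      + 2 * ⟪σ (e 0) (e 1), σ (e 0) (e 1)⟫ := by
    simp [frameSqSum, Fin.sum_univ_two, hσ (e 1) (e 0)]
    ring
  simp only [chenDefect, h5, h6, h4, h3, hT]
  simp only [← real_inner_self_eq_norm_sq]
  simp only [inner_sub_left, inner_sub_right, inner_add_left, inner_add_right,
    real_inner_smul_left, inner_smul_right, Finset.sum_sub_distrib, real_inner_comm _ c,
    Finset.sum_const, Finset.card_univ, Fintype.card_fin, nsmul_eq_mul, h2]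
  push_cast
  rw [show (k : ℝ) + 2 - 1 = k + 1 by ring]
  field_simp
  ring

theorem chenDefect_adapted_nonneg {k : ℕ} {σ : V →ₗ[ℝ] V →ₗ[ℝ] X} (hσ : ∀ u v, σ u v = σ v u)
    (e : Fin (k + 2) → V) : 0 ≤ chenDefect σ e ![e 0, e 1] := by
  rw [chenDefect_eq_sum hσ e _ rfl]
  have : 0 ≤ ∑ i : Fin k, ∑ j : Fin k,
      if i = j then 0 else ‖σ (e i.succ.succ) (e j.succ.succ)‖ ^ 2 :=
    Finset.sum_nonneg fun i _ ↦ Finset.sum_nonneg fun j _ ↦ by split_ifs <;> positivity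
  positivity

theorem chenDefect_adapted_eq_zero_iff {k : ℕ} {σ : V →ₗ[ℝ] V →ₗ[ℝ] X}
    (hσ : ∀ u v, σ u v = σ v u) (e : Fin (k + 2) → V) :
    chenDefect σ e ![e 0, e 1] = 0 ↔ IsChenBlock σ e := by
  set c := ((k : ℝ) + 1)⁻¹ • frameSum σ e with hc
  rw [chenDefect_eq_sum hσ e c hc]
  constructor
  · intro h
    have hoff : ∀ i j : Fin k,
        0 ≤ if i = j then 0 else ‖σ (e i.succ.succ) (e j.succ.succ)‖ ^ 2 := by
      intro i j
      split_ifs <;> positivity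
    have p1 : 0 ≤ ‖σ (e 0) (e 0) + σ (e 1) (e 1) - c‖ ^ 2 := by positivity
    have p2 : 0 ≤ ∑ i : Fin k, ‖σ (e i.succ.succ) (e i.succ.succ) - c‖ ^ 2 := by positivity
    have p3 : 0 ≤ ∑ i : Fin k, ‖σ (e 0) (e i.succ.succ)‖ ^ 2 := by positivity
    have p4 : 0 ≤ ∑ i : Fin k, ‖σ (e 1) (e i.succ.succ)‖ ^ 2 := by positivity
    have p5 : 0 ≤ ∑ i : Fin k, ∑ j : Fin k,
        if i = j then 0 else ‖σ (e i.succ.succ) (e j.succ.succ)‖ ^ 2 :=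
      Finset.sum_nonneg fun i _ ↦ Finset.sum_nonneg fun j _ ↦ hoff i j
    have z1 : ‖σ (e 0) (e 0) + σ (e 1) (e 1) - c‖ ^ 2 = 0 := by linarith
    have z2 : ∑ i : Fin k, ‖σ (e i.succ.succ) (e i.succ.succ) - c‖ ^ 2 = 0 := by linarith
    have z3 : ∑ i : Fin k, ‖σ (e 0) (e i.succ.succ)‖ ^ 2 = 0 := by linarith
    have z4 : ∑ i : Fin k, ‖σ (e 1) (e i.succ.succ)‖ ^ 2 = 0 := by linarith
    have z5 : ∑ i : Fin k, ∑ j : Fin k,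
        (if i = j then 0 else ‖σ (e i.succ.succ) (e j.succ.succ)‖ ^ 2) = 0 := by linarith
    rw [Finset.sum_eq_zero_iff_of_nonneg fun i _ ↦ by positivity] at z2 z3 z4
    rw [Finset.sum_eq_zero_iff_of_nonneg fun i _ ↦ Finset.sum_nonneg fun j _ ↦ hoff i j] at z5
    refine ⟨fun i ↦ by simpa using z3 i, fun i ↦ by simpa using z4 i, fun i j hij ↦ ?_,
      fun i ↦ ?_⟩
    · have := z5 i (Finset.mem_univ i)
      rw [Finset.sum_eq_zero_iff_of_nonneg fun j _ ↦ hoff i j] at this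
      simpa [hij] using this j (Finset.mem_univ j)
    · have := z2 i (Finset.mem_univ i)
      simp only [ne_eq, OfNat.ofNat_ne_zero, not_false_eq_true, pow_eq_zero_iff, norm_eq_zero,
        sub_eq_zero] at z1 this
      rw [z1, this]
  · intro h
    have hk : (k : ℝ) + 1 ≠ 0 := by positivity
    -- In block form each of the `k + 1` averaged vectors equals `σ₀₀ + σ₁₁`, so the mean does too
    -- and every deviation vanishes.
    have hca : c = σ (e 0) (e 0) + σ (e 1) (e 1) := by
      rw [hc, inv_smul_eq_iff₀ hk, frameSum_succ_succ]
      simp only [h.diag, Finset.sum_const, Finset.card_univ, Fintype.card_fin]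
      rw [add_smul, one_smul, Nat.cast_smul_eq_nsmul, add_comm]
    have hoff : ∀ i j : Fin k,
        (if i = j then 0 else ‖σ (e i.succ.succ) (e j.succ.succ)‖ ^ 2) = 0 := by
      intro i j
      by_cases hij : i = j <;> simp [hij, h.off]
    simp [hca, h.diag, h.zero, h.one, hoff]

/-- A symmetric bilinear form on a plane is diagonal in some orthonormal basis. -/
theorem exists_orthonormal_pair_diagonal (B : V →ₗ[ℝ] V →ₗ[ℝ] ℝ) (hB : ∀ u v, B u v = B v u)
    {w : Fin 2 → V} (hw : Orthonormal ℝ w) :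
    ∃ w' : Fin 2 → V, Orthonormal ℝ w' ∧
      Submodule.span ℝ (range w') = Submodule.span ℝ (range w) ∧ B (w' 0) (w' 1) = 0 := by
  set p : ℝ → Fin 2 → V := fun t ↦ ![Real.cos t • w 0 + Real.sin t • w 1,
    -Real.sin t • w 0 + Real.cos t • w 1] with hp
  have hpB (t : ℝ) : B (p t 0) (p t 1) = -Real.cos t * Real.sin t * B (w 0) (w 0)
      + (Real.cos t ^ 2 - Real.sin t ^ 2) * B (w 0) (w 1)
      + Real.cos t * Real.sin t * B (w 1) (w 1) := by
    simp [hp, hB (w 1) (w 0)]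
    ring
  -- The off-diagonal entry in the basis rotated by `t` passes from `B(w₀, w₁)` at `t = 0` to
  -- `-B(w₀, w₁)` at `t = π / 2`, so it vanishes in between.
  obtain ⟨t, -, ht⟩ : (0 : ℝ) ∈ (fun t ↦ B (p t 0) (p t 1)) '' uIcc 0 (Real.pi / 2) := by
    refine intermediate_value_uIcc ?_ ?_
    · simp only [hpB]
      fun_prop
    · simp only [hpB]
      rw [mem_uIcc]
      rcases le_total 0 (B (w 0) (w 1)) with h | h <;> simp [h]
  have hw' := orthonormal_iff_ite.1 hw
  have h00 := hw' 0 0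
  have h01 := hw' 0 1
  have h10 := hw' 1 0
  have h11 := hw' 1 1
  simp only [reduceIte, Fin.isValue, zero_ne_one, one_ne_zero] at h00 h01 h10 h11
  have hcs := Real.cos_sq_add_sin_sq t
  have q00 : ⟪p t 0, p t 0⟫ = 1 := by
    change ⟪Real.cos t • w 0 + Real.sin t • w 1, Real.cos t • w 0 + Real.sin t • w 1⟫ = 1
    simp only [inner_add_left, inner_add_right, real_inner_smul_left, real_inner_smul_right, h00,
      h01, h10, h11]
    linarith
  have q01 : ⟪p t 0, p t 1⟫ = 0 := by
    change ⟪Real.cos t • w 0 + Real.sin t • w 1, -Real.sin t • w 0 + Real.cos t • w 1⟫ = 0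
    simp only [inner_add_left, inner_add_right, real_inner_smul_left, real_inner_smul_right, h00,
      h01, h10, h11]
    ring
  have q11 : ⟪p t 1, p t 1⟫ = 1 := by
    change ⟪-Real.sin t • w 0 + Real.cos t • w 1, -Real.sin t • w 0 + Real.cos t • w 1⟫ = 1
    simp only [inner_add_left, inner_add_right, real_inner_smul_left, real_inner_smul_right, h00,
      h01, h10, h11]
    linarith
  have horth : Orthonormal ℝ (p t) := by
    rw [orthonormal_iff_ite]
    intro i j
    fin_cases i <;> fin_cases j
    · exact q00
    · exact q01
    · exact (real_inner_comm _ _).trans q01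
    · exact q11
  have : FiniteDimensional ℝ (Submodule.span ℝ (range w)) :=
    FiniteDimensional.span_of_finite ℝ (finite_range w)
  refine ⟨p t, horth, ?_, ht⟩
  refine Submodule.eq_of_le_of_finrank_eq ?_ ?_
  · rw [Submodule.span_le]
    rintro _ ⟨i, rfl⟩
    have m0 : w 0 ∈ Submodule.span ℝ (range w) := Submodule.subset_span (mem_range_self 0)
    have m1 : w 1 ∈ Submodule.span ℝ (range w) := Submodule.subset_span (mem_range_self 1)
    fin_cases i
    · exact add_mem (Submodule.smul_mem _ _ m0) (Submodule.smul_mem _ _ m1)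
    · exact add_mem (Submodule.smul_mem _ _ m0) (Submodule.smul_mem _ _ m1)
  · rw [finrank_span_eq_card horth.linearIndependent, finrank_span_eq_card hw.linearIndependent]

/-- Two orthonormal vectors extend to an orthonormal basis with prescribed positions. -/
theorem exists_orthonormal_extension_pair [FiniteDimensional ℝ V] {r : ℕ}
    (hr : Module.finrank ℝ V = r) {a b : V} (ha : ⟪a, a⟫ = 1) (hb : ⟪b, b⟫ = 1)
    (hab : ⟪a, b⟫ = 0) {i j : Fin r} (hij : i ≠ j) :
    ∃ e : Fin r → V, Orthonormal ℝ e ∧ e i = a ∧ e j = b := by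
  have hv : Orthonormal ℝ
      (({i, j} : Set (Fin r)).domRestrict fun l ↦ if l = i then a else b) := by
    rw [orthonormal_iff_ite]
    intro x y
    change ⟪if x.1 = i then a else b, if y.1 = i then a else b⟫ = _
    simp only [Subtype.ext_iff]
    rcases x.2 with hx | hx <;> rcases y.2 with hy | hy <;> rw [hx, hy]
    · simp only [reduceIte, ha]
    · simp only [reduceIte, hij, hij.symm, hab]
    · simp only [reduceIte, hij.symm, real_inner_comm, hab]
    · simp only [reduceIte, hij.symm, hb]
  obtain ⟨B, hB⟩ := hv.exists_orthonormalBasis_extension_of_card_eq (by simp [hr])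
  exact ⟨B, B.orthonormal, by simpa using hB i (by simp), by simpa [hij.symm] using hB j (by simp)⟩

theorem exists_orthonormal_extension_single [FiniteDimensional ℝ V] {r : ℕ}
    (hr : Module.finrank ℝ V = r) {a : V} (ha : ⟪a, a⟫ = 1) (i : Fin r) :
    ∃ e : Fin r → V, Orthonormal ℝ e ∧ e i = a := by
  have hv : Orthonormal ℝ (({i} : Set (Fin r)).domRestrict fun _ ↦ a) := by
    rw [orthonormal_iff_ite]
    intro x y
    change ⟪a, a⟫ = _
    rw [if_pos (Subsingleton.elim _ _), ha]
  obtain ⟨B, hB⟩ := hv.exists_orthonormalBasis_extension_of_card_eq (by simp [hr])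
  exact ⟨B, B.orthonormal, hB i rfl⟩

theorem Orthonormal.span_range_eq_top [FiniteDimensional ℝ V] {r : ℕ}
    (hr : Module.finrank ℝ V = r) {e : Fin r → V} (he : Orthonormal ℝ e) :
    Submodule.span ℝ (range e) = ⊤ :=
  he.linearIndependent.span_eq_top_of_card_eq_finrank' (by simp [hr])

end ChenAlgebra

/-! ### From the vector condition on `σ` to the matrices of the shape operators. -/

section ChenFrames

open scoped RealInnerProductSpace

variable {V : Type*} [NormedAddCommGroup V] [InnerProductSpace ℝ V]
  {W : Type*} [NormedAddCommGroup W] [InnerProductSpace ℝ W]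

/-- A frame adapted to a plane and to the normal space of an isometric map `T`, in which the
bilinear map `σ` has the shape of the equality case of Chen's inequality. -/
structure IsChenShapeFrame {n r : ℕ} (T : V →ₗ[ℝ] W) (σ : V →ₗ[ℝ] V →ₗ[ℝ] W)
    (P : Submodule ℝ V) (e : Fin n → V) (ν : Fin r → W) : Prop where
  orthonormal_tangent : Orthonormal ℝ e
  orthonormal_normal : Orthonormal ℝ ν
  normal : ∀ s u, ⟪ν s, T u⟫ = 0
  plane : Submodule.span ℝ (e '' {i | (i : ℕ) < 2}) = P
  first : ∃ a b : ℝ, ∀ s : Fin r, (s : ℕ) = 0 →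
    (Matrix.of fun i j ↦ ⟪σ (e i) (e j), ν s⟫) = blockFirst n a b
  other : ∀ s : Fin r, (s : ℕ) ≠ 0 → ∃ c d : ℝ,
    (Matrix.of fun i j ↦ ⟪σ (e i) (e j), ν s⟫) = blockOther n c d

variable {T : V →ₗ[ℝ] W} {σ : V →ₗ[ℝ] V →ₗ[ℝ] W}

theorem mem_orthogonal_range_iff {v : W} : v ∈ T.rangeᗮ ↔ ∀ u, ⟪v, T u⟫ = 0 := by
  simp [Submodule.mem_orthogonal']

/-- Normal vectors orthogonal to an orthonormal basis of the normal space vanish. -/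
theorem eq_zero_of_inner_normal_frame [FiniteDimensional ℝ W] {r : ℕ}
    (hr : Module.finrank ℝ (T.rangeᗮ : Submodule ℝ W) = r) {ν : Fin r → W}
    (hν : Orthonormal ℝ ν) (hn : ∀ s u, ⟪ν s, T u⟫ = 0) {v : W} (hv : ∀ u, ⟪v, T u⟫ = 0)
    (h : ∀ s, ⟪v, ν s⟫ = 0) : v = 0 := by
  set ν' : Fin r → (T.rangeᗮ : Submodule ℝ W) :=
    fun s ↦ ⟨ν s, mem_orthogonal_range_iff.2 (hn s)⟩
  have hν' : Orthonormal ℝ ν' := by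
    rw [orthonormal_iff_ite] at hν ⊢
    exact hν
  set v' : (T.rangeᗮ : Submodule ℝ W) := ⟨v, mem_orthogonal_range_iff.2 hv⟩
  have h1 := hν'.sum_inner_smul_of_mem_span (v := v')
    (by rw [hν'.span_range_eq_top hr]; trivial)
  have h2 (s : Fin r) : ⟪ν' s, v'⟫ = 0 := (real_inner_comm _ _).trans (h s)
  simp only [h2, zero_smul, Finset.sum_const_zero] at h1
  exact (congrArg Subtype.val h1).symm

theorem span_image_lt_two {k : ℕ} (e : Fin (k + 2) → V) :
    Submodule.span ℝ (e '' {i | (i : ℕ) < 2}) = Submodule.span ℝ (range ![e 0, e 1]) := by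
  congr 1
  rw [Matrix.range_cons, Matrix.range_cons, Matrix.range_empty]
  ext v
  constructor
  · rintro ⟨i, hi, rfl⟩
    rcases i with ⟨i, h⟩
    simp only [mem_ofPred_eq] at hi
    interval_cases i
    · exact Or.inl rfl
    · exact Or.inr (Or.inl rfl)
  · rintro (rfl | rfl | h)
    · exact ⟨0, by simp, rfl⟩
    · exact ⟨1, by simp, rfl⟩
    · exact h.elim

theorem Orthonormal.pair {k : ℕ} {e : Fin (k + 2) → V} (he : Orthonormal ℝ e) :
    Orthonormal ℝ ![e 0, e 1] := by
  have : ![e 0, e 1] = e ∘ ![0, 1] := by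
    ext i; fin_cases i <;> rfl
  rw [this]
  refine he.comp _ fun i j h ↦ ?_
  fin_cases i <;> fin_cases j <;> simp_all

/-- Both matrix shapes have the block zeros and satisfy `Aᵢᵢ = A₀₀ + A₁₁` for `i ≥ 2`, with both
sides zero in the second shape. Since `σ` is normal, identities tested against a normal basis are
vector identities. -/
theorem IsChenShapeFrame.isChenBlock [FiniteDimensional ℝ W] {k r : ℕ}
    (hr : Module.finrank ℝ (T.rangeᗮ : Submodule ℝ W) = r) {P : Submodule ℝ V}
    {e : Fin (k + 2) → V} {ν : Fin r → W} (h : IsChenShapeFrame T σ P e ν)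
    (hn : ∀ u v z, ⟪σ u v, T z⟫ = 0) : IsChenBlock σ e := by
  have entries (s : Fin r) : (∀ i : Fin k, ⟪σ (e 0) (e i.succ.succ), ν s⟫ = 0) ∧
      (∀ i : Fin k, ⟪σ (e 1) (e i.succ.succ), ν s⟫ = 0) ∧
      (∀ i j : Fin k, i ≠ j → ⟪σ (e i.succ.succ) (e j.succ.succ), ν s⟫ = 0) ∧
      ∀ i : Fin k, ⟪σ (e i.succ.succ) (e i.succ.succ), ν s⟫ =
        ⟪σ (e 0) (e 0), ν s⟫ + ⟪σ (e 1) (e 1), ν s⟫ := by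
    by_cases hs : (s : ℕ) = 0
    · obtain ⟨a, b, hab⟩ := h.first
      have hM (i j) : ⟪σ (e i) (e j), ν s⟫ = blockFirst (k + 2) a b i j := by
        rw [← hab s hs]; rfl
      simp only [hM, blockFirst]
      refine ⟨fun i ↦ ?_, fun i ↦ ?_, fun i j hij ↦ ?_, fun i ↦ ?_⟩
      · exact Matrix.diagonal_apply_ne _ (by simp [Fin.ext_iff])
      · exact Matrix.diagonal_apply_ne _ (by simp [Fin.ext_iff])
      · exact Matrix.diagonal_apply_ne _ (by simpa [Fin.ext_iff] using hij)
      · simp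
    · obtain ⟨c, d, hcd⟩ := h.other s hs
      have hM (i j) : ⟪σ (e i) (e j), ν s⟫ = blockOther (k + 2) c d i j := by
        rw [← hcd]; rfl
      simp [hM, blockOther]
  have ext {v : W} (hv : ∀ z, ⟪v, T z⟫ = 0) (hv' : ∀ s, ⟪v, ν s⟫ = 0) : v = 0 :=
    eq_zero_of_inner_normal_frame hr h.orthonormal_normal h.normal hv hv'
  refine ⟨fun i ↦ ext (hn _ _) fun s ↦ (entries s).1 i,
    fun i ↦ ext (hn _ _) fun s ↦ (entries s).2.1 i,
    fun i j hij ↦ ext (hn _ _) fun s ↦ (entries s).2.2.1 i j hij, fun i ↦ ?_⟩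
  rw [← sub_eq_zero]
  refine ext (fun z ↦ ?_) fun s ↦ ?_
  · simp only [inner_sub_left, inner_add_left, hn]
    simp
  · rw [inner_sub_left, inner_add_left, (entries s).2.2.2 i, sub_self]

/-- Equality in Chen's inequality gives adapted frames for every admissible first normal. -/
theorem exists_isChenShapeFrame [FiniteDimensional ℝ V] {k r : ℕ}
    (hV : Module.finrank ℝ V = k + 2) (hσ : ∀ u v, σ u v = σ v u) {e : Fin (k + 2) → V}
    {w : Fin 2 → V} (he : Orthonormal ℝ e) (hw : Orthonormal ℝ w)
    (h : chenDefect σ e w = 0) (N : W)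
    (hN : ∀ v, (∀ u, ⟪v, T u⟫ = 0) → ⟪v, N⟫ = 0 → ⟪frameSum σ e, v⟫ = 0) :
    ∃ e' : Fin (k + 2) → V, ∀ ν : Fin r → W, Orthonormal ℝ ν → (∀ s u, ⟪ν s, T u⟫ = 0) →
      (∀ s : Fin r, (s : ℕ) = 0 → ν s = N) →
      IsChenShapeFrame T σ (Submodule.span ℝ (range w)) e' ν := by
  -- Only the first shape operator must be diagonal on the plane, so the plane's basis is chosen to
  -- diagonalise the component of `σ` along `N`.
  obtain ⟨w', hw', hspan, hdiag⟩ := exists_orthonormal_pair_diagonal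
    (σ.compr₂ (innerₗ W N)) (fun u v ↦ by simp [hσ u v]) hw
  have hite := orthonormal_iff_ite.1 hw'
  obtain ⟨e', he', e0, e1⟩ := exists_orthonormal_extension_pair hV (a := w' 0) (b := w' 1)
    (i := 0) (j := 1) (by simpa using hite 0 0) (by simpa using hite 1 1)
    (by simpa using hite 0 1) (by simp)
  have hpair : ![e' 0, e' 1] = w' := by
    ext i; fin_cases i <;> simp [e0, e1]
  have htop : Submodule.span ℝ (range e) = Submodule.span ℝ (range e') := by
    rw [he.span_range_eq_top hV, he'.span_range_eq_top hV]
  have hblock : IsChenBlock σ e' := by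
    rw [← chenDefect_adapted_eq_zero_iff hσ, hpair, ← h]
    exact chenDefect_eq σ he' he hw' hw htop.symm hspan
  refine ⟨e', fun ν hν hn hν0 ↦ ⟨he', hν, hn, ?_, ?_, fun s hs ↦ ?_⟩⟩
  · rw [span_image_lt_two, hpair, hspan]
  · refine ⟨⟪σ (e' 0) (e' 0), N⟫, ⟪σ (e' 1) (e' 1), N⟫, fun s hs ↦ ?_⟩
    rw [hν0 s hs]
    have h01 : ⟪σ (e' 0) (e' 1), N⟫ = 0 := by
      rw [e0, e1, real_inner_comm]
      simpa using hdiag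
    ext i j
    simp only [Matrix.of_apply, blockFirst]
    induction i using Fin.cases with
    | zero =>
      induction j using Fin.cases with
      | zero => simp
      | succ j =>
        induction j using Fin.cases with
        | zero => simpa using h01
        | succ j => rw [hblock.zero, inner_zero_left, Matrix.diagonal_apply_ne]; simp [Fin.ext_iff]
    | succ i =>
      induction i using Fin.cases with
      | zero =>
        induction j using Fin.cases with
        | zero => simpa [hσ (e' 1) (e' 0)] using h01
        | succ j =>
          induction j using Fin.cases with
          | zero => simp
          | succ j =>
            rw [Fin.succ_zero_eq_one, hblock.one, inner_zero_left, Matrix.diagonal_apply_ne]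
            simp [Fin.ext_iff]
      | succ i =>
        induction j using Fin.cases with
        | zero =>
          rw [hσ, hblock.zero, inner_zero_left, Matrix.diagonal_apply_ne]; simp [Fin.ext_iff]
        | succ j =>
          induction j using Fin.cases with
          | zero =>
            rw [Fin.succ_zero_eq_one, hσ, hblock.one, inner_zero_left, Matrix.diagonal_apply_ne]
            simp [Fin.ext_iff]
          | succ j =>
            by_cases hij : i = j
            · subst hij
              rw [hblock.diag, inner_add_left]
              simp
            · rw [hblock.off i j hij, inner_zero_left, Matrix.diagonal_apply_ne]
              simpa [Fin.ext_iff] using hij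
  · refine ⟨⟪σ (e' 0) (e' 0), ν s⟫, ⟪σ (e' 0) (e' 1), ν s⟫, ?_⟩
    have hs0 : ⟪ν s, N⟫ = 0 := by
      rw [← hν0 ⟨0, by omega⟩ rfl, orthonormal_iff_ite.1 hν, if_neg]
      exact fun h ↦ hs (congrArg Fin.val h)
    -- By `hN`, normals orthogonal to `N` are orthogonal to `tr σ`, which in block form is `(k +
    -- 1)(σ₀₀ + σ₁₁)`; hence the block for `ν s` is traceless.
    have htr := hN (ν s) (hn s) hs0
    rw [frameSum_eq σ he he' htop, frameSum_succ_succ] at htr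
    simp only [hblock.diag, Finset.sum_const, Finset.card_univ, Fintype.card_fin] at htr
    rw [← succ_nsmul', ← Nat.cast_smul_eq_nsmul ℝ, inner_smul_left] at htr
    have htr' : ⟪σ (e' 0) (e' 0) + σ (e' 1) (e' 1), ν s⟫ = 0 := by
      refine (mul_eq_zero.1 htr).resolve_left ?_
      simp only [RCLike.conj_to_real]
      positivity
    have h11 : ⟪σ (e' 1) (e' 1), ν s⟫ = -⟪σ (e' 0) (e' 0), ν s⟫ := by
      rw [inner_add_left] at htr'
      linarith
    ext i j
    simp only [Matrix.of_apply, blockOther]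
    induction i using Fin.cases with
    | zero =>
      induction j using Fin.cases with
      | zero => simp
      | succ j =>
        induction j using Fin.cases with
        | zero => simp
        | succ j => rw [hblock.zero]; simp
    | succ i =>
      induction i using Fin.cases with
      | zero =>
        induction j using Fin.cases with
        | zero => simp [hσ (e' 1) (e' 0)]
        | succ j =>
          induction j using Fin.cases with
          | zero => simp [h11]
          | succ j => rw [Fin.succ_zero_eq_one, hblock.one]; simp
      | succ i =>
        induction j using Fin.cases with
        | zero => rw [hσ, hblock.zero]; simp
        | succ j =>
          induction j using Fin.cases with
          | zero => rw [Fin.succ_zero_eq_one, hσ, hblock.one]; simp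
          | succ j =>
            by_cases hij : i = j
            · subst hij
              rw [hblock.diag, htr']
              simp
            · rw [hblock.off i j hij]
              simp

/-- The algebraic part of Chen's theorem. -/
theorem chen_algebraic [FiniteDimensional ℝ V] [FiniteDimensional ℝ W] {k r : ℕ}
    (hV : Module.finrank ℝ V = k + 2) (hr : Module.finrank ℝ (T.rangeᗮ : Submodule ℝ W) = r)
    (hσ : ∀ u v, σ u v = σ v u) (hn : ∀ u v z, ⟪σ u v, T z⟫ = 0) {ξ ζ : W}
    (hξ : ∀ u, ⟪ξ, T u⟫ = 0) (hζ : ∀ u, ⟪ζ, T u⟫ = 0) (hξξ : ⟪ξ, ξ⟫ = 1) (hζζ : ⟪ζ, ζ⟫ = 1)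
    (hζξ : ⟪ζ, ξ⟫ = 0) {e : Fin (k + 2) → V} {w : Fin 2 → V} (he : Orthonormal ℝ e)
    (hw : Orthonormal ℝ w) :
    0 ≤ chenDefect σ e w ∧
    (chenDefect σ e w = 0 ↔ ∃ (e' : Fin (k + 2) → V) (ν : Fin r → W),
      IsChenShapeFrame T σ (Submodule.span ℝ (range w)) e' ν) ∧
    (chenDefect σ e w = 0 ∧ ⟪frameSum σ e, ξ⟫ = 0 ↔ ∃ (e' : Fin (k + 2) → V) (ν : Fin r → W),
      IsChenShapeFrame T σ (Submodule.span ℝ (range w)) e' ν ∧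
        ∀ s : Fin r, (s : ℕ) + 1 = r → ν s = ξ) := by
  set ξ' : (T.rangeᗮ : Submodule ℝ W) := ⟨ξ, mem_orthogonal_range_iff.2 hξ⟩ with hξ'
  set ζ' : (T.rangeᗮ : Submodule ℝ W) := ⟨ζ, mem_orthogonal_range_iff.2 hζ⟩ with hζ'
  -- The orthonormal normals `ζ`, `ξ` force `r ≥ 2`, so the first and last positions of a normal
  -- frame are different and can be prescribed independently.
  have h2r : 2 ≤ r := by
    have h : Orthonormal ℝ ![ζ', ξ'] := by
      rw [orthonormal_iff_ite]
      intro i j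
      fin_cases i <;> fin_cases j
      · exact hζζ
      · exact hζξ
      · exact (real_inner_comm _ _).trans hζξ
      · exact hξξ
    simpa [hr] using h.linearIndependent.fintype_card_le_finrank
  have defect_eq {e' : Fin (k + 2) → V} (he' : Orthonormal ℝ e')
      (hP : Submodule.span ℝ (range ![e' 0, e' 1]) = Submodule.span ℝ (range w)) :
      chenDefect σ e w = chenDefect σ e' ![e' 0, e' 1] :=
    chenDefect_eq σ he he' hw he'.pair
      (by rw [he.span_range_eq_top hV, he'.span_range_eq_top hV]) hP.symm
  have of_frame {e' : Fin (k + 2) → V} {ν : Fin r → W}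
      (h : IsChenShapeFrame T σ (Submodule.span ℝ (range w)) e' ν) : chenDefect σ e w = 0 := by
    rw [defect_eq h.orthonormal_tangent (by rw [← span_image_lt_two, h.plane]),
      chenDefect_adapted_eq_zero_iff hσ]
    exact h.isChenBlock hr hn
  have hHn (u : V) : ⟪frameSum σ e, T u⟫ = 0 := by
    simp [frameSum, sum_inner, hn]
  have lift {a b : W} (ha : ∀ u, ⟪a, T u⟫ = 0) (hb : ∀ u, ⟪b, T u⟫ = 0) (haa : ⟪a, a⟫ = 1)
      (hbb : ⟪b, b⟫ = 1) (hab : ⟪a, b⟫ = 0) : ∃ ν : Fin r → W, Orthonormal ℝ ν ∧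
      (∀ s u, ⟪ν s, T u⟫ = 0) ∧ (∀ s : Fin r, (s : ℕ) = 0 → ν s = a) ∧
        ∀ s : Fin r, (s : ℕ) + 1 = r → ν s = b := by
    obtain ⟨ν, hν, h0, h1⟩ := exists_orthonormal_extension_pair hr
      (a := ⟨a, mem_orthogonal_range_iff.2 ha⟩) (b := ⟨b, mem_orthogonal_range_iff.2 hb⟩)
      haa hbb hab (i := ⟨0, by omega⟩) (j := ⟨r - 1, by omega⟩)
      (by simp only [ne_eq, Fin.mk.injEq]; omega)
    refine ⟨fun s ↦ ν s, ?_, fun s ↦ mem_orthogonal_range_iff.1 (ν s).2, fun s hs ↦ ?_,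
      fun s hs ↦ ?_⟩
    · rw [orthonormal_iff_ite] at hν ⊢
      exact hν
    · have hs' : s = ⟨0, by omega⟩ := Fin.ext hs
      exact (congrArg (fun t ↦ (ν t : W)) hs').trans (congrArg Subtype.val h0)
    · have hs' : s = ⟨r - 1, by omega⟩ := Fin.ext (by simp only; omega)
      exact (congrArg (fun t ↦ (ν t : W)) hs').trans (congrArg Subtype.val h1)
  have nonzero (hH : frameSum σ e ≠ 0) : ∃ N : W, (∀ u, ⟪N, T u⟫ = 0) ∧ ⟪N, N⟫ = 1 ∧
      (∀ v, ⟪v, N⟫ = 0 ↔ ⟪frameSum σ e, v⟫ = 0) := by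
    have hnorm : ‖frameSum σ e‖ ≠ 0 := norm_ne_zero_iff.2 hH
    refine ⟨‖frameSum σ e‖⁻¹ • frameSum σ e, fun u ↦ ?_, ?_, fun v ↦ ?_⟩
    · rw [real_inner_smul_left, hHn, mul_zero]
    · rw [real_inner_self_eq_norm_sq, norm_smul, norm_inv, norm_norm, inv_mul_cancel₀ hnorm,
        one_pow]
    · rw [real_inner_smul_right, mul_eq_zero, real_inner_comm]
      simp [hnorm]
  refine ⟨?_, ⟨fun h ↦ ?_, ?_⟩, ⟨?_, ?_⟩⟩
  · have hite := orthonormal_iff_ite.1 hw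
    obtain ⟨e', he', e0, e1⟩ := exists_orthonormal_extension_pair hV (a := w 0) (b := w 1)
      (i := 0) (j := 1) (by simpa using hite 0 0) (by simpa using hite 1 1)
      (by simpa using hite 0 1) (by simp)
    have hpair : ![e' 0, e' 1] = w := by
      ext i; fin_cases i <;> simp [e0, e1]
    rw [defect_eq he' (by rw [hpair])]
    exact chenDefect_adapted_nonneg hσ e'
  -- If `tr σ = 0` any unit normal may come first, and `ζ` is available. Otherwise the first normal
  -- is the direction of `tr σ`; it need not be orthogonal to `ξ`, so nothing else is prescribed.
  · by_cases hH : frameSum σ e = 0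
    · obtain ⟨ν, hν, hνn, hν0, -⟩ := lift hζ hξ hζζ hξξ hζξ
      obtain ⟨e', he'⟩ := exists_isChenShapeFrame (T := T) (r := r) hV hσ he hw h ζ
        (by simp [hH])
      exact ⟨e', ν, he' ν hν hνn hν0⟩
    · obtain ⟨N, hN, hNN, hNH⟩ := nonzero hH
      obtain ⟨ν, hν, h0⟩ := exists_orthonormal_extension_single hr
        (a := ⟨N, mem_orthogonal_range_iff.2 hN⟩) hNN ⟨0, by omega⟩
      obtain ⟨e', he'⟩ := exists_isChenShapeFrame (T := T) (r := r) hV hσ he hw h N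
        (fun v _ hv ↦ (hNH v).1 hv)
      refine ⟨e', fun s ↦ ν s, he' _ ?_ (fun s ↦ mem_orthogonal_range_iff.1 (ν s).2)
        fun s hs ↦ ?_⟩
      · rw [orthonormal_iff_ite] at hν ⊢
        exact hν
      · have hs' : s = ⟨0, by omega⟩ := Fin.ext hs
        exact (congrArg (fun t ↦ (ν t : W)) hs').trans (congrArg Subtype.val h0)
  · rintro ⟨e', ν, h⟩
    exact of_frame h
  · rintro ⟨h, hHξ⟩
    by_cases hH : frameSum σ e = 0
    · obtain ⟨ν, hν, hνn, hν0, hν1⟩ := lift hζ hξ hζζ hξξ hζξ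
      obtain ⟨e', he'⟩ := exists_isChenShapeFrame (T := T) (r := r) hV hσ he hw h ζ
        (by simp [hH])
      exact ⟨e', ν, he' ν hν hνn hν0, hν1⟩
    · obtain ⟨N, hN, hNN, hNH⟩ := nonzero hH
      obtain ⟨ν, hν, hνn, hν0, hν1⟩ := lift hN hξ hNN hξξ
        ((real_inner_comm _ _).trans ((hNH ξ).2 hHξ))
      obtain ⟨e', he'⟩ := exists_isChenShapeFrame (T := T) (r := r) hV hσ he hw h N
        (fun v _ hv ↦ (hNH v).1 hv)
      exact ⟨e', ν, he' ν hν hνn hν0, hν1⟩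
  -- The last index is not the first because `r ≥ 2`, so the shape operator of `ξ` has the traceless
  -- form and `⟨tr σ, ξ⟩ = 0`.
  · rintro ⟨e', ν, h, hν⟩
    refine ⟨of_frame h, ?_⟩
    have hblock := h.isChenBlock hr hn
    obtain ⟨c, d, hcd⟩ := h.other ⟨r - 1, by omega⟩ (by simp only; omega)
    rw [hν ⟨r - 1, by omega⟩ (by simp only; omega)] at hcd
    have h00 : ⟪σ (e' 0) (e' 0), ξ⟫ = c := by
      simpa [blockOther] using congrFun₂ hcd 0 0
    have h11 : ⟪σ (e' 1) (e' 1), ξ⟫ = -c := by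
      simpa [blockOther] using congrFun₂ hcd 1 1
    rw [frameSum_eq σ he h.orthonormal_tangent
      (by rw [he.span_range_eq_top hV, h.orthonormal_tangent.span_range_eq_top hV]),
      frameSum_succ_succ, inner_add_left, sum_inner]
    simp only [hblock.diag, inner_add_left, h00, h11, add_neg_cancel, Finset.sum_const_zero,
      add_zero]

end ChenFrames

/-! ### Transfer of the coordinate results to manifolds and immersions. -/

section InChart

theorem ContinuousLinearMap.isInvertible_of_pos {E : Type*} [NormedAddCommGroup E]
    [NormedSpace ℝ E] [FiniteDimensional ℝ E] {B : E →L[ℝ] E →L[ℝ] ℝ}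
    (hB : ∀ u, u ≠ 0 → 0 < B u u) : B.IsInvertible := by
  have hinj : Function.Injective (B : E →ₗ[ℝ] E →L[ℝ] ℝ) := by
    rw [injective_iff_map_eq_zero]
    intro u hu
    by_contra h
    have := hB u h
    rw [show B u = 0 from hu] at this
    simp at this
  have hdim : Module.finrank ℝ E = Module.finrank ℝ (E →L[ℝ] ℝ) := by
    rw [← (LinearMap.toContinuousLinearMap (𝕜 := ℝ) (E := E) (F' := ℝ)).finrank_eq]
    exact (Subspace.dual_finrank_eq (K := ℝ) (V := E)).symm
  exact ⟨(LinearEquiv.ofInjectiveOfFinrankEq (B : E →ₗ[ℝ] E →L[ℝ] ℝ) hinj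
    hdim).toContinuousLinearEquiv, by ext; rfl⟩

variable {E : Type*} [NormedAddCommGroup E] [NormedSpace ℝ E]
  {M : Type*} [TopologicalSpace M] [ChartedSpace E M] [IsManifold 𝓘(ℝ, E) ∞ M]

/-- The differential of the inverse chart, as an endomorphism of the model space. -/
def chartFrameEnd (x₀ : M) (y : E) : E →L[ℝ] E := chartFrame x₀ y

/-- A metric at a point, as a bilinear form on the model space. -/
def SmoothMetric.form (g : SmoothMetric E M) (x : M) : E →L[ℝ] E →L[ℝ] ℝ := g.inner x

/-- A field of endomorphisms at a point, as an endomorphism of the model space. -/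
def endForm (φ : ∀ x : M, TangentSpace 𝓘(ℝ, E) x →L[ℝ] TangentSpace 𝓘(ℝ, E) x) (x : M) :
    E →L[ℝ] E := φ x

/-- A one-form at a point, as a linear form on the model space. -/
def oneForm (η : ∀ x : M, TangentSpace 𝓘(ℝ, E) x →L[ℝ] ℝ) (x : M) : E →L[ℝ] ℝ := η x

theorem chartFrameEnd_self (x₀ : M) :
    chartFrameEnd x₀ (extChartAt 𝓘(ℝ, E) x₀ x₀) = ContinuousLinearMap.id ℝ E :=
  chartFrame_self x₀

theorem SmoothMetric.inChart_apply (g : SmoothMetric E M) (x₀ : M) (y u v : E) :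
    g.inChart x₀ y u v = g.form ((extChartAt 𝓘(ℝ, E) x₀).symm y) (chartFrameEnd x₀ y u)
      (chartFrameEnd x₀ y v) := rfl

theorem SmoothMetric.inChart_self (g : SmoothMetric E M) (x₀ : M) (u v : E) :
    g.inChart x₀ (extChartAt 𝓘(ℝ, E) x₀ x₀) u v = g.form x₀ u v := by
  rw [g.inChart_apply, chartFrameEnd_self, extChartAt_to_inv]
  rfl

theorem SmoothMetric.form_symm (g : SmoothMetric E M) (x : M) (u v : E) :
    g.form x u v = g.form x v u := g.symm x u v

theorem SmoothMetric.isLocalMetric_inChart [FiniteDimensional ℝ E] (g : SmoothMetric E M)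
    (x₀ : M) : IsLocalMetric (g.inChart x₀) (extChartAt 𝓘(ℝ, E) x₀ x₀) where
  contDiffAt := (g.contDiffAt_inChart x₀).of_le ENat.LEInfty.out
  symm := .of_forall fun y u v ↦ by
    rw [g.inChart_apply, g.inChart_apply, g.form_symm]
  invertible := by
    filter_upwards [eventually_mem_extChartAt_target x₀] with y hy
    refine ContinuousLinearMap.isInvertible_of_pos fun u hu ↦ ?_
    refine g.pos _ _ fun h ↦ hu ?_
    exact (chartFrame_isInvertible hy).injective (h.trans (map_zero _).symm)

variable {S : AlmostContactMetric E M} {x₀ : M} {y : E}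

theorem chartFrameEnd_inverse_apply (hy : y ∈ (extChartAt 𝓘(ℝ, E) x₀).target) (u : E) :
    chartFrameEnd x₀ y ((chartFrameEnd x₀ y).inverse u) = u :=
  (chartFrame_isInvertible hy).self_apply_inverse u

theorem AlmostContactMetric.isAlmostContactTuple_form (S : AlmostContactMetric E M) (x : M) :
    IsAlmostContactTuple (S.metric.form x) (endForm S.phi x) (S.xi x : E) (oneForm S.eta x) where
  symm := S.metric.symm x
  phi_phi := S.phi_phi x
  eta_xi := S.eta_xi x
  phi_xi := S.phi_xi x
  eta_phi := S.eta_phi x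
  inner_eq := S.inner_eq x
  inner_phi := S.inner_phi x
  inner_xi := S.inner_xi x

/-- The differential of the inverse chart is an isomorphism intertwining the coordinate tensors with
those on the tangent space, so each algebraic relation pulls back. -/
theorem AlmostContactMetric.isAlmostContactTuple_inChart (S : AlmostContactMetric E M)
    (hy : y ∈ (extChartAt 𝓘(ℝ, E) x₀).target) :
    IsAlmostContactTuple (S.metric.inChart x₀ y) (endInChart S.phi x₀ y)
      (vectorFieldInChart S.xi x₀ y) (oneFormInChart S.eta x₀ y) := by
  have hx := S.isAlmostContactTuple_form ((extChartAt 𝓘(ℝ, E) x₀).symm y)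
  set x := (extChartAt 𝓘(ℝ, E) x₀).symm y
  set A := chartFrameEnd x₀ y
  have hφ (u : E) : A (endInChart S.phi x₀ y u) = endForm S.phi x (A u) :=
    chartFrameEnd_inverse_apply hy _
  have hξ : A (vectorFieldInChart S.xi x₀ y) = (S.xi x : E) := chartFrameEnd_inverse_apply hy _
  have hη (u : E) : oneFormInChart S.eta x₀ y u = oneForm S.eta x (A u) := rfl
  have hg (u v : E) : S.metric.inChart x₀ y u v = S.metric.form x (A u) (A v) := rfl
  have hinj : Function.Injective A := (chartFrame_isInvertible hy).injective
  constructor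
  · intro u v
    rw [hg, hg, hx.symm]
  · intro u
    apply hinj
    rw [hφ, hφ, map_add, map_neg, map_smul, hξ, hη, hx.phi_phi]
  · rw [hη, hξ, hx.eta_xi]
  · apply hinj
    rw [hφ, hξ, map_zero, hx.phi_xi]
  · intro u
    rw [hη, hφ, hx.eta_phi]
  · intro u v
    rw [hg, hg, hφ, hφ, hη, hη, hx.inner_eq]
  · intro u v
    rw [hg, hg, hφ, hφ, hx.inner_phi]
  · intro u
    rw [hg, hη, hξ, hx.inner_xi]

theorem endInChart_self (φ : ∀ x : M, TangentSpace 𝓘(ℝ, E) x →L[ℝ] TangentSpace 𝓘(ℝ, E) x)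
    (x₀ : M) : endInChart φ x₀ (extChartAt 𝓘(ℝ, E) x₀ x₀) = endForm φ x₀ := by
  change (chartFrameEnd x₀ (extChartAt 𝓘(ℝ, E) x₀ x₀)).inverse.comp
    ((endForm φ ((extChartAt 𝓘(ℝ, E) x₀).symm (extChartAt 𝓘(ℝ, E) x₀ x₀))).comp
      (chartFrameEnd x₀ (extChartAt 𝓘(ℝ, E) x₀ x₀))) = _
  rw [chartFrameEnd_self, extChartAt_to_inv, ContinuousLinearMap.inverse_id]
  rfl

theorem AlmostContactMetric.endForm_h (S : AlmostContactMetric E M) (x : M) :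
    endForm S.h x = (1 / 2 : ℝ) • coordLieDerivEnd (vectorFieldInChart S.xi x)
      (endInChart S.phi x) (extChartAt 𝓘(ℝ, E) x x) := rfl

/-- The tensor `h` of a contact metric manifold is symmetric. -/
theorem AlmostContactMetric.IsContact.form_h (hS : S.IsContact) (x : M) (u v : E) :
    S.metric.form x (endForm S.h x u) v = S.metric.form x u (endForm S.h x v) := by
  have hne : (∞ : ℕ∞ω) ≠ 0 := by simp
  have h := coordLieDerivEnd_symm
    ((S.metric.contDiffAt_inChart x).differentiableAt hne)
    ((contDiffAt_endInChart S.smooth_phi x).differentiableAt hne)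
    ((contDiffAt_vectorFieldInChart S.smooth_xi x).differentiableAt hne)
    ((contDiffAt_oneFormInChart S.smooth_eta x).of_le ENat.LEInfty.out)
    ((eventually_mem_extChartAt_target x).mono fun y hy ↦ S.isAlmostContactTuple_inChart hy)
    ((eventually_mem_extChartAt_target x).mono fun y hy u v ↦ hS x y hy u v) u v
  rw [S.metric.inChart_self, S.metric.inChart_self] at h
  rw [S.endForm_h]
  simp only [smul_apply, map_smul, h]

theorem AlmostContactMetric.IsContact.h_phi (hS : S.IsContact) (x : M) (u : E) :
    endForm S.h x (endForm S.phi x u) = -endForm S.phi x (endForm S.h x u) := by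
  have hne : (∞ : ℕ∞ω) ≠ 0 := by simp
  have h := coordLieDerivEnd_phi
    ((contDiffAt_endInChart S.smooth_phi x).differentiableAt hne)
    ((contDiffAt_vectorFieldInChart S.smooth_xi x).differentiableAt hne)
    ((contDiffAt_oneFormInChart S.smooth_eta x).differentiableAt hne)
    ((eventually_mem_extChartAt_target x).mono fun y hy ↦ S.isAlmostContactTuple_inChart hy)
    ((eventually_mem_extChartAt_target x).mono fun y hy u v ↦ hS x y hy u v) u
  rw [endInChart_self] at h
  rw [S.endForm_h]
  simp only [smul_apply, map_smul, h, smul_neg]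

/-- A skew and a symmetric operator that anticommute have a symmetric product. -/
theorem AlmostContactMetric.IsContact.form_phiH (hS : S.IsContact) (x : M) (u v : E) :
    S.metric.form x (endForm S.phiH x u) v = S.metric.form x u (endForm S.phiH x v) := by
  change S.metric.form x (endForm S.phi x (endForm S.h x u)) v =
    S.metric.form x u (endForm S.phi x (endForm S.h x v))
  have h1 := (S.isAlmostContactTuple_form x).inner_phi (endForm S.h x u) v
  have h2 := hS.form_h x u (endForm S.phi x v)
  rw [hS.h_phi, map_neg] at h2
  linarith

variable {E' : Type*} [NormedAddCommGroup E'] [NormedSpace ℝ E']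
  {N : Type*} [TopologicalSpace N] [ChartedSpace E' N] [IsManifold 𝓘(ℝ, E') ∞ N]
  {F : M → N}

omit [IsManifold 𝓘(ℝ, E) ∞ M] [IsManifold 𝓘(ℝ, E') ∞ N] in
theorem writtenInExtChartAt_self (F : M → N) (p : M) :
    writtenInExtChartAt 𝓘(ℝ, E) 𝓘(ℝ, E') p F (extChartAt 𝓘(ℝ, E) p p) =
      extChartAt 𝓘(ℝ, E') (F p) (F p) := by
  simp [writtenInExtChartAt]

omit [IsManifold 𝓘(ℝ, E) ∞ M] [IsManifold 𝓘(ℝ, E') ∞ N] in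
theorem ContMDiff.contDiffAt_writtenInExtChartAt (hF : ContMDiff 𝓘(ℝ, E) 𝓘(ℝ, E') ∞ F) (p : M) :
    ContDiffAt ℝ ∞ (writtenInExtChartAt 𝓘(ℝ, E) 𝓘(ℝ, E') p F) (extChartAt 𝓘(ℝ, E) p p) := by
  have h := (contMDiffAt_iff.1 (hF p)).2
  rw [modelWithCornersSelf_coe, range_id, contDiffWithinAt_univ] at h
  exact h

/-- The differential of a map at a point, as a map between the model spaces. -/
def mfderivL (F : M → N) (p : M) : E →L[ℝ] E' := mfderiv 𝓘(ℝ, E) 𝓘(ℝ, E') F p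

omit [IsManifold 𝓘(ℝ, E) ∞ M] [IsManifold 𝓘(ℝ, E') ∞ N] in
theorem fderiv_writtenInExtChartAt_self (hF : ContMDiff 𝓘(ℝ, E) 𝓘(ℝ, E') ∞ F) (p : M) :
    fderiv ℝ (writtenInExtChartAt 𝓘(ℝ, E) 𝓘(ℝ, E') p F) (extChartAt 𝓘(ℝ, E) p p) =
      mfderivL F p := by
  have h : MDifferentiableAt 𝓘(ℝ, E) 𝓘(ℝ, E') F p := (hF p).mdifferentiableAt (by simp)
  rw [← fderivWithin_univ]
  unfold mfderivL mfderiv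
  simp only [modelWithCornersSelf_coe, range_id]
  exact (if_pos h).symm

/-- Chain rule for `F ∘ ψ⁻¹ = ψ'⁻¹ ∘ f`, where `f` is `F` in the charts `ψ`, `ψ'`. It is stated on a
neighbourhood because the resulting coordinate identities are differentiated. -/
theorem eventually_chartFrame_comp (hF : ContMDiff 𝓘(ℝ, E) 𝓘(ℝ, E') ∞ F) (p : M) :
    ∀ᶠ z in 𝓝 (extChartAt 𝓘(ℝ, E) p p),
      (extChartAt 𝓘(ℝ, E') (F p)).symm (writtenInExtChartAt 𝓘(ℝ, E) 𝓘(ℝ, E') p F z) =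
        F ((extChartAt 𝓘(ℝ, E) p).symm z) ∧
      ∀ u : E, chartFrameEnd (F p) (writtenInExtChartAt 𝓘(ℝ, E) 𝓘(ℝ, E') p F z)
        (fderiv ℝ (writtenInExtChartAt 𝓘(ℝ, E) 𝓘(ℝ, E') p F) z u) =
        mfderivL F ((extChartAt 𝓘(ℝ, E) p).symm z) (chartFrameEnd p z u) := by
  have hM : IsManifold 𝓘(ℝ, E) 1 M := IsManifold.of_le (n := ∞) (by simp)
  have hN : IsManifold 𝓘(ℝ, E') 1 N := IsManifold.of_le (n := ∞) (by simp)
  set f := writtenInExtChartAt 𝓘(ℝ, E) 𝓘(ℝ, E') p F with hf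
  have hsrc : ∀ᶠ z in 𝓝 (extChartAt 𝓘(ℝ, E) p p),
      F ((extChartAt 𝓘(ℝ, E) p).symm z) ∈ (extChartAt 𝓘(ℝ, E') (F p)).source := by
    have hc : ContinuousAt (fun z ↦ F ((extChartAt 𝓘(ℝ, E) p).symm z))
        (extChartAt 𝓘(ℝ, E) p p) :=
      hF.continuous.continuousAt.comp (continuousAt_extChartAt_symm p)
    refine hc.eventually ?_
    simp only [extChartAt_to_inv]
    exact extChartAt_source_mem_nhds (F p)
  have heq : ∀ᶠ z in 𝓝 (extChartAt 𝓘(ℝ, E) p p), (extChartAt 𝓘(ℝ, E') (F p)).symm (f z) =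
      F ((extChartAt 𝓘(ℝ, E) p).symm z) :=
    hsrc.mono fun z hz ↦ (extChartAt 𝓘(ℝ, E') (F p)).left_inv hz
  have hf1 : ContDiffAt ℝ 1 f (extChartAt 𝓘(ℝ, E) p p) :=
    (hF.contDiffAt_writtenInExtChartAt p).of_le ENat.LEInfty.out
  filter_upwards [eventually_mem_extChartAt_target p, hsrc, heq.eventually_nhds,
    hf1.eventually (by simp)] with z h1 h2 h3 h4
  refine ⟨h3.self_of_nhds, fun u ↦ ?_⟩
  have hft : f z ∈ (extChartAt 𝓘(ℝ, E') (F p)).target :=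
    (extChartAt 𝓘(ℝ, E') (F p)).map_source h2
  have d1 : MDifferentiableAt 𝓘(ℝ, E') 𝓘(ℝ, E') (extChartAt 𝓘(ℝ, E') (F p)).symm (f z) := by
    have h := mdifferentiableWithinAt_extChartAt_symm hft
    rwa [modelWithCornersSelf_coe, range_id, mdifferentiableWithinAt_univ] at h
  have d2 : MDifferentiableAt 𝓘(ℝ, E) 𝓘(ℝ, E) (extChartAt 𝓘(ℝ, E) p).symm z := by
    have h := mdifferentiableWithinAt_extChartAt_symm h1
    rwa [modelWithCornersSelf_coe, range_id, mdifferentiableWithinAt_univ] at h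
  have d3 : MDifferentiableAt 𝓘(ℝ, E) 𝓘(ℝ, E') f z :=
    (h4.differentiableAt (by norm_num)).mdifferentiableAt
  have d4 : MDifferentiableAt 𝓘(ℝ, E) 𝓘(ℝ, E') F ((extChartAt 𝓘(ℝ, E) p).symm z) :=
    (hF _).mdifferentiableAt (by simp)
  have e1 : mfderivL ((extChartAt 𝓘(ℝ, E') (F p)).symm ∘ f) z =
      (chartFrameEnd (F p) (f z)).comp (fderiv ℝ f z) := by
    rw [← mfderiv_eq_fderiv]
    exact mfderiv_comp z d1 d3
  have e2 : mfderivL (F ∘ (extChartAt 𝓘(ℝ, E) p).symm) z =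
      (mfderivL F ((extChartAt 𝓘(ℝ, E) p).symm z)).comp (chartFrameEnd p z) :=
    mfderiv_comp z d4 d2
  have e3 : mfderivL ((extChartAt 𝓘(ℝ, E') (F p)).symm ∘ f) z =
      mfderivL (F ∘ (extChartAt 𝓘(ℝ, E) p).symm) z :=
    Filter.EventuallyEq.mfderiv_eq (I := 𝓘(ℝ, E)) (I' := 𝓘(ℝ, E')) h3
  exact DFunLike.congr_fun (e1.symm.trans (e3.trans e2)) u

theorem IsIsometricImmersion.form_eq {g : SmoothMetric E M} {g' : SmoothMetric E' N}
    (hF : IsIsometricImmersion g g' F) (p : M) (u v : E) :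
    g'.form (F p) (mfderivL F p u) (mfderivL F p v) = g.form p u v :=
  hF.inner_eq p u v

theorem IsIsometricImmersion.eventually_inChart {g : SmoothMetric E M} {g' : SmoothMetric E' N}
    (hF : IsIsometricImmersion g g' F) (p : M) :
    ∀ᶠ z in 𝓝 (extChartAt 𝓘(ℝ, E) p p), ∀ u v, g.inChart p z u v =
      g'.inChart (F p) (writtenInExtChartAt 𝓘(ℝ, E) 𝓘(ℝ, E') p F z)
        (fderiv ℝ (writtenInExtChartAt 𝓘(ℝ, E) 𝓘(ℝ, E') p F) z u)
        (fderiv ℝ (writtenInExtChartAt 𝓘(ℝ, E) 𝓘(ℝ, E') p F) z v) := by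
  filter_upwards [eventually_chartFrame_comp hF.smooth p] with z hz u v
  rw [g.inChart_apply, g'.inChart_apply, hz.1, hz.2, hz.2, hF.form_eq]

/-- On a C-totally real submanifold of a contact metric manifold, `φ` maps tangent vectors to
normal vectors. -/
theorem IsCTotallyReal.form_phi {S : AlmostContactMetric E' N} (hS : S.IsContact)
    (hF : ContMDiff 𝓘(ℝ, E) 𝓘(ℝ, E') ∞ F) (hC : IsCTotallyReal (E := E) S F) (p : M) (u v : E) :
    S.metric.form (F p) (mfderivL F p u) (endForm S.phi (F p) (mfderivL F p v)) = 0 := by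
  set f := writtenInExtChartAt 𝓘(ℝ, E) 𝓘(ℝ, E') p F with hf
  set y := extChartAt 𝓘(ℝ, E) p p with hy
  have hfy : f y = extChartAt 𝓘(ℝ, E') (F p) (F p) := writtenInExtChartAt_self F p
  have hfd : ContDiffAt ℝ 2 f y :=
    (hF.contDiffAt_writtenInExtChartAt p).of_le ENat.LEInfty.out
  have hd0 : DifferentiableAt ℝ f y := hfd.differentiableAt (by norm_num)
  have hd1 : DifferentiableAt ℝ (fderiv ℝ f) y :=
    (hfd.fderiv_right (m := 1) (by norm_num)).differentiableAt (by norm_num)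
  have hη : DifferentiableAt ℝ (oneFormInChart S.eta (F p)) (f y) := by
    rw [hfy]
    exact (contDiffAt_oneFormInChart S.smooth_eta (F p)).differentiableAt (by simp)
  have hηf : DifferentiableAt ℝ (fun z ↦ oneFormInChart S.eta (F p) (f z)) y := hη.comp y hd0
  have hcomp : fderiv ℝ (fun z ↦ oneFormInChart S.eta (F p) (f z)) y =
      (fderiv ℝ (oneFormInChart S.eta (F p)) (f y)).comp (fderiv ℝ f y) := fderiv_comp y hη hd0
  have hc (a : E) := differentiableAt_const (𝕜 := ℝ) (x := y) a
  -- Derivative of the vanishing pullback of `η`. Its antisymmetric part says that `dη` vanishes on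
  -- tangent vectors, the second derivative of `f` being symmetric.
  have key (a b : E) : fderiv ℝ (oneFormInChart S.eta (F p)) (f y) (fderiv ℝ f y a)
      (fderiv ℝ f y b) + oneFormInChart S.eta (F p) (f y) (fderiv ℝ (fderiv ℝ f) y a b) = 0 := by
    have h : (fun z ↦ oneFormInChart S.eta (F p) (f z) (fderiv ℝ f z b)) =ᶠ[𝓝 y]
        fun _ ↦ 0 := by
      filter_upwards [eventually_chartFrame_comp hF p] with z hz
      change oneForm S.eta ((extChartAt 𝓘(ℝ, E') (F p)).symm (f z))
        (chartFrameEnd (F p) (f z) (fderiv ℝ f z b)) = 0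
      rw [hz.1, hz.2]
      exact hC _ (chartFrameEnd p z b)
    have h' := congrArg (fun L : E →L[ℝ] ℝ ↦ L a) h.fderiv_eq
    rw [fderiv_clm_apply hηf (hd1.clm_apply (hc b)), fderiv_clm_apply hd1 (hc b), hcomp] at h'
    simp at h'
    linarith
  have k1 := key u v
  have k2 := key v u
  rw [hfd.fderiv_fderiv_symm u v] at k1
  have hd := hS (F p) (f y) (by rw [hfy]; exact mem_extChartAt_target (F p))
    (fderiv ℝ f y u) (fderiv ℝ f y v)
  have h0 : coordExtDeriv (oneFormInChart S.eta (F p)) (f y) (fderiv ℝ f y u)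
      (fderiv ℝ f y v) = 0 := by
    rw [coordExtDeriv]
    linarith
  rw [h0, hfy, S.metric.inChart_self, endInChart_self,
    fderiv_writtenInExtChartAt_self hF p] at hd
  exact hd.symm

/-- The second fundamental form at a point, as a bilinear map between the model spaces. -/
def secondForm (g : SmoothMetric E M) (g' : SmoothMetric E' N) (F : M → N) (p : M) :
    E →ₗ[ℝ] E →ₗ[ℝ] E' :=
  LinearMap.mk₂ ℝ (fun u v ↦ secondFundamentalForm g g' F p u v)
    (fun u u' v ↦ by
      simp only [secondFundamentalForm, ← christoffelL_apply, map_add, add_apply]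
      abel)
    (fun c u v ↦ by
      simp only [secondFundamentalForm, ← christoffelL_apply, map_smul, smul_apply, smul_add,
        smul_sub])
    (fun u v v' ↦ by
      simp only [secondFundamentalForm, ← christoffelL_apply, map_add]
      abel)
    (fun c u v ↦ by
      simp only [secondFundamentalForm, ← christoffelL_apply, map_smul, smul_add, smul_sub])

theorem secondForm_eq_coordSecondForm (g : SmoothMetric E M) (g' : SmoothMetric E' N)
    (F : M → N) (p : M) (u v : E) :
    secondForm g g' F p u v = coordSecondForm (g.inChart p) (g'.inChart (F p))
      (writtenInExtChartAt 𝓘(ℝ, E) 𝓘(ℝ, E') p F) (extChartAt 𝓘(ℝ, E) p p) u v := rfl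

section IsometricImmersion

variable [FiniteDimensional ℝ E] [FiniteDimensional ℝ E'] {g : SmoothMetric E M}
  {g' : SmoothMetric E' N}

theorem IsIsometricImmersion.secondForm_symm (hF : IsIsometricImmersion g g' F) (p : M)
    (u v : E) : secondForm g g' F p u v = secondForm g g' F p v u := by
  rw [secondForm_eq_coordSecondForm, secondForm_eq_coordSecondForm]
  refine coordSecondForm_symm (g.isLocalMetric_inChart p) ?_
    ((hF.smooth.contDiffAt_writtenInExtChartAt p).of_le ENat.LEInfty.out) u v
  rw [writtenInExtChartAt_self]
  exact g'.isLocalMetric_inChart (F p)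

theorem IsIsometricImmersion.form_secondForm (hF : IsIsometricImmersion g g' F) (p : M)
    (u v w : E) : g'.form (F p) (secondForm g g' F p u v) (mfderivL F p w) = 0 := by
  have h := inner_coordSecondForm_tangent (g.isLocalMetric_inChart p)
    (by rw [writtenInExtChartAt_self]; exact g'.isLocalMetric_inChart (F p))
    ((hF.smooth.contDiffAt_writtenInExtChartAt p).of_le ENat.LEInfty.out)
    (hF.eventually_inChart p) u v w
  rwa [writtenInExtChartAt_self, g'.inChart_self, fderiv_writtenInExtChartAt_self hF.smooth] at h

/-- The curvature tensor at a point, on the model space. -/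
def SmoothMetric.curv (g : SmoothMetric E M) (x : M) (u v w : E) : E := g.curvature x u v w

/-- The Gauss equation of an isometric immersion. -/
theorem IsIsometricImmersion.gauss (hF : IsIsometricImmersion g g' F) (p : M) (u v w z : E) :
    g.form p (g.curv p u v w) z =
      g'.form (F p) (g'.curv (F p) (mfderivL F p u) (mfderivL F p v) (mfderivL F p w))
          (mfderivL F p z)
        + g'.form (F p) (secondForm g g' F p v w) (secondForm g g' F p u z)
        - g'.form (F p) (secondForm g g' F p u w) (secondForm g g' F p v z) := by
  have h := gauss_equation (g.isLocalMetric_inChart p)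
    (by rw [writtenInExtChartAt_self]; exact g'.isLocalMetric_inChart (F p))
    ((hF.smooth.contDiffAt_writtenInExtChartAt p).of_le ENat.LEInfty.out)
    (hF.eventually_inChart p) u v w z
  simp only [← secondForm_eq_coordSecondForm] at h
  rw [writtenInExtChartAt_self, g'.inChart_self, g'.inChart_self, g'.inChart_self, g.inChart_self,
    fderiv_writtenInExtChartAt_self hF.smooth] at h
  exact h

end IsometricImmersion

end InChart

/-! ### The algebraic theorem for arbitrary inner products. -/

section BilinearForms

open scoped RealInnerProductSpace

variable {V : Type*} [AddCommGroup V] [Module ℝ V] {W : Type*} [AddCommGroup W] [Module ℝ W]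

/-- A symmetric positive definite bilinear form. -/
structure IsInnerForm (B : V → V → ℝ) : Prop where
  symm : ∀ u v, B u v = B v u
  add_left : ∀ u v w, B (u + v) w = B u w + B v w
  smul_left : ∀ (c : ℝ) u v, B (c • u) v = c * B u v
  pos : ∀ u, u ≠ 0 → 0 < B u u

/-- The inner product given by a symmetric positive definite bilinear form. -/
abbrev IsInnerForm.core {B : V → V → ℝ} (hB : IsInnerForm B) : InnerProductSpace.Core ℝ V where
  inner := B
  conj_inner_symm u v := hB.symm v u
  re_inner_nonneg u := by
    by_cases h : u = 0
    · subst h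
      have := hB.smul_left 0 0 0
      rw [zero_smul, zero_mul] at this
      exact this.ge
    · exact (hB.pos u h).le
  add_left := hB.add_left
  smul_left u v c := hB.smul_left c u v
  definite u h := by
    by_contra h'
    exact (hB.pos u h').ne' h

/-- A frame adapted to a plane and to the normal space of an isometric map `T`, in which the
bilinear map `σ` has the shape of the equality case of Chen's inequality; orthonormality refers to
the forms `B` and `C`. -/
structure IsChenFormFrame {n r : ℕ} (B : V → V → ℝ) (C : W → W → ℝ) (T : V →ₗ[ℝ] W)
    (σ : V →ₗ[ℝ] V →ₗ[ℝ] W) (P : Submodule ℝ V) (e : Fin n → V) (ν : Fin r → W) : Prop where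
  orthonormal_tangent : ∀ i j, B (e i) (e j) = if i = j then 1 else 0
  orthonormal_normal : ∀ i j, C (ν i) (ν j) = if i = j then 1 else 0
  normal : ∀ s u, C (ν s) (T u) = 0
  plane : Submodule.span ℝ (e '' {i | (i : ℕ) < 2}) = P
  first : ∃ a b : ℝ, ∀ s : Fin r, (s : ℕ) = 0 →
    (Matrix.of fun i j ↦ C (σ (e i) (e j)) (ν s)) = blockFirst n a b
  other : ∀ s : Fin r, (s : ℕ) ≠ 0 → ∃ c d : ℝ,
    (Matrix.of fun i j ↦ C (σ (e i) (e j)) (ν s)) = blockOther n c d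

/-- The difference of `‖∑ σ(eᵢ, eᵢ)‖²` and `∑ ‖σ(eᵢ, eⱼ)‖²` with respect to the form `C`. -/
def formGap (C : W → W → ℝ) (σ : V →ₗ[ℝ] V →ₗ[ℝ] W) {n : ℕ} (e : Fin n → V) : ℝ :=
  ∑ i, ∑ j, (C (σ (e i) (e i)) (σ (e j) (e j)) - C (σ (e i) (e j)) (σ (e i) (e j)))

/-- The defect in Chen's inequality with respect to the form `C`. -/
def formDefect (C : W → W → ℝ) (σ : V →ₗ[ℝ] V →ₗ[ℝ] W) {n : ℕ} (e : Fin n → V)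
    (w : Fin 2 → V) : ℝ :=
  ((n : ℝ) - 2) / (2 * ((n : ℝ) - 1)) * C (∑ i, σ (e i) (e i)) (∑ i, σ (e i) (e i))
    - formGap C σ e / 2 + formGap C σ w / 2

/-- `V` and `W` are bare modules here, so the forms `B` and `C` can be installed as their inner
products. The model spaces of the manifolds already carry Euclidean ones, which would be the wrong
ones. -/
theorem chen_form [FiniteDimensional ℝ V] [FiniteDimensional ℝ W] {B : V → V → ℝ}
    {C : W → W → ℝ} (hB : IsInnerForm B) (hC : IsInnerForm C) {T : V →ₗ[ℝ] W}
    {σ : V →ₗ[ℝ] V →ₗ[ℝ] W} {k r : ℕ} (hV : Module.finrank ℝ V = k + 2)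
    (hr : Module.finrank ℝ W - (k + 2) = r) (hT : ∀ u v, C (T u) (T v) = B u v)
    (hσ : ∀ u v, σ u v = σ v u) (hn : ∀ u v z, C (σ u v) (T z) = 0) {ξ ζ : W}
    (hξ : ∀ u, C ξ (T u) = 0) (hζ : ∀ u, C ζ (T u) = 0) (hξξ : C ξ ξ = 1) (hζζ : C ζ ζ = 1)
    (hζξ : C ζ ξ = 0) {e : Fin (k + 2) → V} {w : Fin 2 → V}
    (he : ∀ i j, B (e i) (e j) = if i = j then 1 else 0)
    (hw : ∀ i j, B (w i) (w j) = if i = j then 1 else 0) :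
    0 ≤ formDefect C σ e w ∧
    (formDefect C σ e w = 0 ↔ ∃ (e' : Fin (k + 2) → V) (ν : Fin r → W),
      IsChenFormFrame B C T σ (Submodule.span ℝ (range w)) e' ν) ∧
    (formDefect C σ e w = 0 ∧ C (∑ i, σ (e i) (e i)) ξ = 0 ↔
      ∃ (e' : Fin (k + 2) → V) (ν : Fin r → W),
      IsChenFormFrame B C T σ (Submodule.span ℝ (range w)) e' ν ∧
        ∀ s : Fin r, (s : ℕ) + 1 = r → ν s = ξ) := by
  let _ : NormedAddCommGroup V := hB.core.toNormedAddCommGroup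
  let _ : InnerProductSpace ℝ V := .ofCore hB.core.toCore
  let _ : NormedAddCommGroup W := hC.core.toNormedAddCommGroup
  let _ : InnerProductSpace ℝ W := .ofCore hC.core.toCore
  have hinj : Function.Injective T := by
    rw [injective_iff_map_eq_zero]
    intro u hu
    by_contra h
    have h1 := hT u u
    have h2 : C 0 (0 : W) = 0 := inner_zero_left (𝕜 := ℝ) (0 : W)
    rw [hu, h2] at h1
    exact (hB.pos u h).ne h1
  have hr' : Module.finrank ℝ (T.rangeᗮ : Submodule ℝ W) = r := by
    have h1 := Submodule.finrank_add_finrank_orthogonal T.range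
    have h2 := LinearMap.finrank_range_of_inj hinj
    omega
  have hframe (e' : Fin (k + 2) → V) (ν : Fin r → W) :
      IsChenFormFrame B C T σ (Submodule.span ℝ (range w)) e' ν ↔
        IsChenShapeFrame T σ (Submodule.span ℝ (range w)) e' ν :=
    ⟨fun h ↦ ⟨orthonormal_iff_ite.2 h.1, orthonormal_iff_ite.2 h.2, h.3, h.4, h.5, h.6⟩,
      fun h ↦ ⟨orthonormal_iff_ite.1 h.1, orthonormal_iff_ite.1 h.2, h.3, h.4, h.5, h.6⟩⟩
  have hgap {n : ℕ} (e : Fin n → V) :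
      formGap C σ e = ⟪frameSum σ e, frameSum σ e⟫ - frameSqSum σ e := by
    simp only [formGap, frameSum, frameSqSum, sum_inner, inner_sum, ← Finset.sum_sub_distrib]
    refine Finset.sum_congr rfl fun i _ ↦ Finset.sum_congr rfl fun j _ ↦ ?_
    rw [real_inner_comm]
    rfl
  have hdefect : formDefect C σ e w = chenDefect σ e w := by
    rw [formDefect, hgap, hgap]
    rfl
  simp only [hframe, hdefect]
  exact chen_algebraic hV hr' hσ hn hξ hζ hξξ hζζ hζξ (orthonormal_iff_ite.2 he)
    (orthonormal_iff_ite.2 hw)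

end BilinearForms

/-! ### Sectional curvature of the submanifold. -/

section Curvature

variable {E : Type*} [NormedAddCommGroup E] [NormedSpace ℝ E]
  {M : Type*} [TopologicalSpace M] [ChartedSpace E M] [IsManifold 𝓘(ℝ, E) ∞ M]
  {E' : Type*} [NormedAddCommGroup E'] [NormedSpace ℝ E']
  {N : Type*} [TopologicalSpace N] [ChartedSpace E' N] [IsManifold 𝓘(ℝ, E') ∞ N]
  {F : M → N}

theorem SmoothMetric.isInnerForm (g : SmoothMetric E M) (x : M) :
    IsInnerForm fun u v : E ↦ g.form x u v where
  symm := g.form_symm x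
  add_left u v w := by rw [map_add, add_apply]
  smul_left c u v := by rw [map_smul, smul_apply, smul_eq_mul]
  pos := g.pos x

/-- The contribution of a tangential form to the sectional curvature. -/
def minorForm {V : Type*} (Q : V → V → ℝ) (u v : V) : ℝ := Q u u * Q v v - Q u v * Q u v

/-- Gauss equation with the ambient curvature inserted. Symmetry of `h` and `φh` turns the last two
tensors into minors. -/
theorem IsIsometricImmersion.sectional_eq [FiniteDimensional ℝ E] [FiniteDimensional ℝ E']
    {S : AlmostContactMetric E' N} {f₁ f₂ f₃ f₄ f₅₁ f₅₂ f₆ : N → ℝ} {g : SmoothMetric E M}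
    (hF : IsIsometricImmersion g S.metric F) (hS : S.IsContact)
    (hf : S.IsGeneralizedKappaMuDivided f₁ f₂ f₃ f₄ f₅₁ f₅₂ f₆)
    (hC : IsCTotallyReal (E := E) S F) (p : M) {u v : E} (hu : g.form p u u = 1)
    (hv : g.form p v v = 1) (huv : g.form p u v = 0) :
    g.sectional p u v = f₁ (F p)
      + f₄ (F p) * (tangentialForm S.metric F p (S.h (F p)) u u
        + tangentialForm S.metric F p (S.h (F p)) v v)
      + f₅₁ (F p) * minorForm (tangentialForm S.metric F p (S.h (F p))) u v
      + f₅₂ (F p) * minorForm (tangentialForm S.metric F p (S.phiH (F p))) u v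
      + (S.metric.form (F p) (secondForm g S.metric F p u u) (secondForm g S.metric F p v v)
        - S.metric.form (F p) (secondForm g S.metric F p u v)
          (secondForm g S.metric F p u v)) := by
  have hsec : g.sectional p u v = g.form p (g.curv p u v v) u /
      (g.form p u u * g.form p v v - g.form p u v ^ 2) := rfl
  rw [hsec, hF.gauss, hu, hv, huv, hF.secondForm_symm p v u]
  -- The vector `ξ` may stay anonymous: each of its occurrences carries a factor `η(X)` or `η(Y)`,
  -- zero on tangent vectors.
  obtain ⟨ξ, hcurv⟩ : ∃ ξ : E', ∀ X Y : E', S.metric.curv (F p) X Y Y =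
      f₁ (F p) • (S.metric.form (F p) Y Y • X - S.metric.form (F p) X Y • Y)
      + f₂ (F p) • (S.metric.form (F p) X (endForm S.phi (F p) Y) • endForm S.phi (F p) Y
        - S.metric.form (F p) Y (endForm S.phi (F p) Y) • endForm S.phi (F p) X
        + (2 * S.metric.form (F p) X (endForm S.phi (F p) Y)) • endForm S.phi (F p) Y)
      + f₃ (F p) • ((oneForm S.eta (F p) X * oneForm S.eta (F p) Y) • Y
        - (oneForm S.eta (F p) Y * oneForm S.eta (F p) Y) • X
        + (S.metric.form (F p) X Y * oneForm S.eta (F p) Y) • ξ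
        - (S.metric.form (F p) Y Y * oneForm S.eta (F p) X) • ξ)
      + f₄ (F p) • (S.metric.form (F p) Y Y • endForm S.h (F p) X
        - S.metric.form (F p) X Y • endForm S.h (F p) Y
        + S.metric.form (F p) (endForm S.h (F p) Y) Y • X
        - S.metric.form (F p) (endForm S.h (F p) X) Y • Y)
      + f₅₁ (F p) • (S.metric.form (F p) (endForm S.h (F p) Y) Y • endForm S.h (F p) X
        - S.metric.form (F p) (endForm S.h (F p) X) Y • endForm S.h (F p) Y)
      + f₅₂ (F p) • (S.metric.form (F p) (endForm S.phiH (F p) Y) Y • endForm S.phiH (F p) X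
        - S.metric.form (F p) (endForm S.phiH (F p) X) Y • endForm S.phiH (F p) Y)
      + f₆ (F p) • ((oneForm S.eta (F p) X * oneForm S.eta (F p) Y) • endForm S.h (F p) Y
        - (oneForm S.eta (F p) Y * oneForm S.eta (F p) Y) • endForm S.h (F p) X
        + (S.metric.form (F p) (endForm S.h (F p) X) Y * oneForm S.eta (F p) Y) • ξ
        - (S.metric.form (F p) (endForm S.h (F p) Y) Y * oneForm S.eta (F p) X) • ξ) :=
    ⟨S.xi (F p), fun X Y ↦ hf (F p) X Y Y⟩
  have hη (z : E) : oneForm S.eta (F p) (mfderivL F p z) = 0 := hC p z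
  have hh := (S.metric.form_symm _ _ _).trans
    (hS.form_h (F p) (mfderivL F p u) (mfderivL F p v)).symm
  have hp := (S.metric.form_symm _ _ _).trans
    (hS.form_phiH (F p) (mfderivL F p u) (mfderivL F p v)).symm
  have hQ (Q : ∀ x : N, TangentSpace 𝓘(ℝ, E') x →L[ℝ] TangentSpace 𝓘(ℝ, E') x) (a b : E) :
      tangentialForm S.metric F p (Q (F p)) a b =
        S.metric.form (F p) (endForm Q (F p) (mfderivL F p a)) (mfderivL F p b) := rfl
  simp only [minorForm, hQ]
  have hvu : g.form p v u = 0 := by rw [g.form_symm, huv]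
  rw [hcurv]
  simp only [hη, hC.form_phi hS hF.smooth, hF.form_eq, hu, hv, huv, hvu, map_add, map_sub,
    map_smul, add_apply, sub_apply, smul_apply, smul_eq_mul]
  rw [hh, hp, S.metric.form_symm (F p) (secondForm g S.metric F p v v)]
  ring

end Curvature

/-! ### Sums over pairs of frame vectors. -/

section Sums

theorem two_mul_sum_sum_Ioi {n : ℕ} (k : Fin n → Fin n → ℝ) (hk : ∀ i j, k i j = k j i) :
    2 * ∑ i, ∑ j ∈ Finset.Ioi i, k i j = ∑ i, ∑ j, k i j - ∑ i, k i i := by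
  have h1 (i : Fin n) : ∑ j, k i j = ∑ j ∈ Finset.Iio i, k i j + k i i +
      ∑ j ∈ Finset.Ioi i, k i j := by
    rw [Fintype.sum_eq_add_sum_compl i, ← Finset.Ioi_disjUnion_Iio, Finset.sum_disjUnion]
    ring
  have h2 : ∑ i, ∑ j ∈ Finset.Iio i, k i j = ∑ i, ∑ j ∈ Finset.Ioi i, k i j := by
    rw [Finset.sum_comm' (t' := Finset.univ) (s' := fun j ↦ Finset.Ioi j) (by simp)]
    exact Finset.sum_congr rfl fun i _ ↦ Finset.sum_congr rfl fun j _ ↦ hk j i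
  simp only [h1, Finset.sum_add_distrib, h2]
  ring

theorem sum_sum_minorForm {V : Type*} (Q : V → V → ℝ) {n : ℕ} (e : Fin n → V) :
    ∑ i, ∑ j, minorForm Q (e i) (e j) = frameTrace Q e ^ 2 - frameNormSq Q e := by
  simp only [minorForm, Finset.sum_sub_distrib, frameTrace, frameNormSq, sq, Finset.sum_mul_sum]
  rw [Finset.sum_comm (f := fun i j ↦ Q (e j) (e i) * Q (e j) (e i))]

end Sums

/-! ### Chen's inequality for C-totally real submanifolds. -/

section ChenInequality

variable {n m : ℕ}
  {M : Type*} [TopologicalSpace M] [ChartedSpace (EuclideanSpace ℝ (Fin n)) M]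
  [IsManifold (𝓡 n) ∞ M]
  {N : Type*} [TopologicalSpace N] [ChartedSpace (EuclideanSpace ℝ (Fin (2 * m + 1))) N]
  [IsManifold (𝓡 (2 * m + 1)) ∞ N]
  {S : AlmostContactMetric (EuclideanSpace ℝ (Fin (2 * m + 1))) N}
  {f₁ f₂ f₃ f₄ f₅₁ f₅₂ f₆ : N → ℝ} {g : SmoothMetric (EuclideanSpace ℝ (Fin n)) M} {F : M → N}

theorem inner_meanCurvature_self (g : SmoothMetric (EuclideanSpace ℝ (Fin n)) M)
    (g' : SmoothMetric (EuclideanSpace ℝ (Fin (2 * m + 1))) N) (F : M → N) (p : M)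
    (e : Fin n → EuclideanSpace ℝ (Fin n)) :
    g'.inner (F p) (meanCurvature g g' F p e) (meanCurvature g g' F p e) =
      (1 / (n : ℝ)) ^ 2 * g'.form (F p) (∑ i, secondForm g g' F p (e i) (e i))
        (∑ i, secondForm g g' F p (e i) (e i)) := by
  change g'.form (F p) ((1 / (n : ℝ)) • ∑ i, secondForm g g' F p (e i) (e i))
    ((1 / (n : ℝ)) • ∑ i, secondForm g g' F p (e i) (e i)) = _
  simp only [map_smul, smul_apply, smul_eq_mul]
  ring

theorem inner_meanCurvature (g : SmoothMetric (EuclideanSpace ℝ (Fin n)) M)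
    (g' : SmoothMetric (EuclideanSpace ℝ (Fin (2 * m + 1))) N) (F : M → N) (p : M)
    (e : Fin n → EuclideanSpace ℝ (Fin n)) (v : EuclideanSpace ℝ (Fin (2 * m + 1))) :
    g'.inner (F p) (meanCurvature g g' F p e) v =
      1 / (n : ℝ) * g'.form (F p) (∑ i, secondForm g g' F p (e i) (e i)) v := by
  change g'.form (F p) ((1 / (n : ℝ)) • ∑ i, secondForm g g' F p (e i) (e i)) v = _
  rw [map_smul, smul_apply, smul_eq_mul]

omit [IsManifold (𝓡 n) ∞ M] in
theorem tangentialForm_h_symm (hS : S.IsContact) (F : M → N) (p : M)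
    (u v : EuclideanSpace ℝ (Fin n)) :
    tangentialForm S.metric F p (S.h (F p)) u v = tangentialForm S.metric F p (S.h (F p)) v u :=
  (hS.form_h (F p) (mfderivL F p u) (mfderivL F p v)).trans (S.metric.form_symm _ _ _)

omit [IsManifold (𝓡 n) ∞ M] in
theorem tangentialForm_phiH_symm (hS : S.IsContact) (F : M → N) (p : M)
    (u v : EuclideanSpace ℝ (Fin n)) :
    tangentialForm S.metric F p (S.phiH (F p)) u v =
      tangentialForm S.metric F p (S.phiH (F p)) v u :=
  (hS.form_phiH (F p) (mfderivL F p u) (mfderivL F p v)).trans (S.metric.form_symm _ _ _)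

theorem frameDet_fin_two {V : Type*} {Q : V → V → ℝ} (hQ : ∀ u v, Q u v = Q v u)
    (w : Fin 2 → V) : frameDet Q w = minorForm Q (w 0) (w 1) := by
  simp only [frameDet, Matrix.det_fin_two, Matrix.of_apply, minorForm, hQ (w 1) (w 0)]

theorem sum_sum_add_add {n : ℕ} (a b : ℝ) (x : Fin n → ℝ) :
    ∑ i, ∑ j, (a + b * (x i + x j)) = n ^ 2 * a + 2 * n * b * ∑ i, x i := by
  simp only [Finset.sum_add_distrib, ← Finset.mul_sum, Finset.sum_const, Finset.card_univ,
    Fintype.card_fin, nsmul_eq_mul]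
  ring

/-- All `fᵢ`-terms cancel, for instance `n(n - 1)/2 - 1 = (n + 1)(n - 2)/2` for `f₁`, and `n²‖H‖² =
‖tr σ‖²` yields the leading coefficient of the defect. -/
theorem IsIsometricImmersion.chenBound_sub (hn : 2 ≤ n)
    (hF : IsIsometricImmersion g S.metric F) (hS : S.IsContact)
    (hf : S.IsGeneralizedKappaMuDivided f₁ f₂ f₃ f₄ f₅₁ f₅₂ f₆)
    (hC : IsCTotallyReal (E := EuclideanSpace ℝ (Fin n)) S F) (p : M)
    {e : Fin n → EuclideanSpace ℝ (Fin n)} (he : g.IsOrthonormal p e)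
    {w : Fin 2 → EuclideanSpace ℝ (Fin n)} (hw : g.IsOrthonormal p w) :
    chenBound S f₁ f₄ f₅₁ f₅₂ g F p e w - (g.scalar p e - g.sectional p (w 0) (w 1)) =
      formDefect (fun u v ↦ S.metric.form (F p) u v) (secondForm g S.metric F p) e w := by
  set q : EuclideanSpace ℝ (Fin n) → EuclideanSpace ℝ (Fin n) → ℝ :=
    tangentialForm S.metric F p (S.h (F p))
  set r : EuclideanSpace ℝ (Fin n) → EuclideanSpace ℝ (Fin n) → ℝ :=
    tangentialForm S.metric F p (S.phiH (F p))
  set C := fun u v ↦ S.metric.form (F p) u v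
  set σ := secondForm g S.metric F p
  have hσs : ∀ u v, σ u v = σ v u := hF.secondForm_symm p
  have hCs : ∀ u v, C u v = C v u := S.metric.form_symm (F p)
  have hqs : ∀ u v, q u v = q v u := tangentialForm_h_symm hS F p
  have hrs : ∀ u v, r u v = r v u := tangentialForm_phiH_symm hS F p
  -- The curvature formula is extended to all pairs, equal ones included, so that `2τ` becomes the
  -- full double sum minus the diagonal. On the diagonal the minors and the `σ` terms vanish.
  set K : EuclideanSpace ℝ (Fin n) → EuclideanSpace ℝ (Fin n) → ℝ := fun u v ↦
    f₁ (F p) + f₄ (F p) * (q u u + q v v) + f₅₁ (F p) * minorForm q u v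
      + f₅₂ (F p) * minorForm r u v + (C (σ u u) (σ v v) - C (σ u v) (σ u v)) with hK
  have hKs (u v : EuclideanSpace ℝ (Fin n)) : K u v = K v u := by
    simp only [hK, minorForm, hqs v u, hrs v u, hσs v u, hCs (σ v v)]
    ring
  have hscal : g.scalar p e = ∑ i, ∑ j ∈ Finset.Ioi i, K (e i) (e j) := by
    refine Finset.sum_congr rfl fun i _ ↦ Finset.sum_congr rfl fun j hj ↦ ?_
    refine hF.sectional_eq hS hf hC p ((he i i).trans (if_pos rfl)) ((he j j).trans (if_pos rfl))
      ((he i j).trans (if_neg (Finset.mem_Ioi.1 hj).ne))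
  have hsect : g.sectional p (w 0) (w 1) = K (w 0) (w 1) :=
    hF.sectional_eq hS hf hC p ((hw 0 0).trans (if_pos rfl)) ((hw 1 1).trans (if_pos rfl))
      ((hw 0 1).trans (if_neg (by decide)))
  have h2 := two_mul_sum_sum_Ioi (fun i j ↦ K (e i) (e j)) fun i j ↦ hKs _ _
  have hdiag : ∑ i, K (e i) (e i) = n * f₁ (F p) + 2 * f₄ (F p) * frameTrace q e := by
    have h (u : EuclideanSpace ℝ (Fin n)) : K u u = f₁ (F p) + 2 * f₄ (F p) * q u u := by
      simp only [hK, minorForm]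
      ring
    simp only [h, Finset.sum_add_distrib, ← Finset.mul_sum, Finset.sum_const, Finset.card_univ,
      Fintype.card_fin, nsmul_eq_mul]
    rfl
  have hsum : ∑ i, ∑ j, K (e i) (e j) = n ^ 2 * f₁ (F p) + 2 * n * f₄ (F p) * frameTrace q e
      + f₅₁ (F p) * (frameTrace q e ^ 2 - frameNormSq q e)
      + f₅₂ (F p) * (frameTrace r e ^ 2 - frameNormSq r e) + formGap C σ e := by
    rw [← sum_sum_minorForm, ← sum_sum_minorForm, frameTrace, ← sum_sum_add_add, formGap]
    simp only [Finset.mul_sum, ← Finset.sum_add_distrib]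
    rfl
  have hgap : formGap C σ w = 2 * (C (σ (w 0) (w 0)) (σ (w 1) (w 1))
      - C (σ (w 0) (w 1)) (σ (w 0) (w 1))) := by
    simp only [formGap, Fin.sum_univ_two, hσs (w 1) (w 0), hCs (σ (w 1) (w 1))]
    ring
  have hn0 : (n : ℝ) ≠ 0 := by positivity
  have hn1 : (n : ℝ) - 1 ≠ 0 := by
    have : (2 : ℝ) ≤ n := by exact_mod_cast hn
    linarith
  have hH := inner_meanCurvature_self g S.metric F p e
  have hbound : chenBound S f₁ f₄ f₅₁ f₅₂ g F p e w =
      ((n : ℝ) - 2) / (2 * ((n : ℝ) - 1)) * C (∑ i, σ (e i) (e i)) (∑ i, σ (e i) (e i))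
      + ((n : ℝ) + 1) * ((n : ℝ) - 2) / 2 * f₁ (F p)
      + f₄ (F p) * (((n : ℝ) - 1) * frameTrace q e - (q (w 0) (w 0) + q (w 1) (w 1)))
      + 1 / 2 * f₅₁ (F p) * (frameTrace q e ^ 2 - frameNormSq q e - 2 * minorForm q (w 0) (w 1))
      - 1 / 2 * f₅₂ (F p) *
        (frameNormSq r e - frameTrace r e ^ 2 + 2 * minorForm r (w 0) (w 1)) := by
    rw [← frameDet_fin_two hqs, ← frameDet_fin_two hrs]
    simp only [chenBound, hH]
    have h1 : frameTrace q w = q (w 0) (w 0) + q (w 1) (w 1) := Fin.sum_univ_two _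
    rw [← h1]
    change (n : ℝ) ^ 2 * ((n : ℝ) - 2) / (2 * ((n : ℝ) - 1)) * ((1 / (n : ℝ)) ^ 2 *
      C (∑ i, σ (e i) (e i)) (∑ i, σ (e i) (e i))) + _ + _ + _ - _ = _
    congr 4
    field_simp
  rw [hbound, hsect, formDefect, hgap, hscal]
  rw [hdiag, hsum] at h2
  simp only [hK] at h2 ⊢
  linear_combination (-1 / 2 : ℝ) * h2

/-- The unit normal vector `φ(dF u)` for a unit tangent vector `u` of a C-totally real
submanifold. -/
theorem IsIsometricImmersion.form_phi_phi (hF : IsIsometricImmersion g S.metric F)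
    (hC : IsCTotallyReal (E := EuclideanSpace ℝ (Fin n)) S F) (p : M)
    (u : EuclideanSpace ℝ (Fin n)) :
    S.metric.form (F p) (endForm S.phi (F p) (mfderivL F p u))
      (endForm S.phi (F p) (mfderivL F p u)) = g.form p u u := by
  have h := (S.isAlmostContactTuple_form (F p)).inner_eq (mfderivL F p u) (mfderivL F p u)
  have h0 : oneForm S.eta (F p) (mfderivL F p u) = 0 := hC p u
  rw [h0, mul_zero, add_zero, hF.form_eq] at h
  exact h.symm

theorem isChenFrame_iff {g' : SmoothMetric (EuclideanSpace ℝ (Fin (2 * m + 1))) N} (p : M)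
    (P : Submodule ℝ (EuclideanSpace ℝ (Fin n))) (e : Fin n → EuclideanSpace ℝ (Fin n))
    (ν : Fin (2 * m + 1 - n) → EuclideanSpace ℝ (Fin (2 * m + 1))) :
    IsChenFrame g g' F p P e ν ↔ IsChenFormFrame (fun u v ↦ g.form p u v)
      (fun u v ↦ g'.form (F p) u v) (mfderivL F p).toLinearMap (secondForm g g' F p) P e ν :=
  ⟨fun h ↦ ⟨h.1, h.2, h.3, h.4, h.5, h.6⟩, fun h ↦ ⟨h.1, h.2, h.3, h.4, h.5, h.6⟩⟩

theorem chen_form_immersion {k : ℕ}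
    {M : Type*} [TopologicalSpace M] [ChartedSpace (EuclideanSpace ℝ (Fin (k + 2))) M]
    [IsManifold (𝓡 (k + 2)) ∞ M] {g : SmoothMetric (EuclideanSpace ℝ (Fin (k + 2))) M} {F : M → N}
    (hS : S.IsContact) (hF : IsIsometricImmersion g S.metric F)
    (hC : IsCTotallyReal (E := EuclideanSpace ℝ (Fin (k + 2))) S F) (p : M)
    {e : Fin (k + 2) → EuclideanSpace ℝ (Fin (k + 2))} (he : g.IsOrthonormal p e)
    {w : Fin 2 → EuclideanSpace ℝ (Fin (k + 2))} (hw : g.IsOrthonormal p w) :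
    0 ≤ formDefect (fun u v ↦ S.metric.form (F p) u v) (secondForm g S.metric F p) e w ∧
    (formDefect (fun u v ↦ S.metric.form (F p) u v) (secondForm g S.metric F p) e w = 0 ↔
      ∃ e' ν, IsChenFrame g S.metric F p (Submodule.span ℝ (range w)) e' ν) ∧
    (formDefect (fun u v ↦ S.metric.form (F p) u v) (secondForm g S.metric F p) e w = 0 ∧
        S.metric.form (F p) (∑ i, secondForm g S.metric F p (e i) (e i)) (S.xi (F p)) = 0 ↔
      ∃ e' ν, IsChenFrame g S.metric F p (Submodule.span ℝ (range w)) e' ν ∧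
        ∀ r : Fin (2 * m + 1 - (k + 2)), (r : ℕ) + 1 = 2 * m + 1 - (k + 2) →
          ν r = S.xi (F p)) := by
  have hA := S.isAlmostContactTuple_form (F p)
  have hη (u : EuclideanSpace ℝ (Fin (k + 2))) : oneForm S.eta (F p) (mfderivL F p u) = 0 :=
    hC p u
  have h := chen_form (r := 2 * m + 1 - (k + 2)) (g.isInnerForm p) (S.metric.isInnerForm (F p))
    (T := (mfderivL F p).toLinearMap) (σ := secondForm g S.metric F p) (by simp) (by simp)
    (hF.form_eq p) (hF.secondForm_symm p) (hF.form_secondForm p) (ξ := S.xi (F p))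
    -- The second unit normal is `φ(dF e₀)`: normal because `φ` maps tangent vectors to normal ones,
    -- of unit length because `η(dF e₀) = 0`, and orthogonal to `ξ` because `η ∘ φ = 0`.
    (ζ := endForm S.phi (F p) (mfderivL F p (e 0)))
    (fun u ↦ (hA.symm _ _).trans ((hA.inner_xi _).trans (hη u)))
    (fun u ↦ (hA.symm _ _).trans (hC.form_phi hS hF.smooth p u (e 0)))
    ((hA.inner_xi _).trans hA.eta_xi)
    ((hF.form_phi_phi hC p (e 0)).trans ((he 0 0).trans (if_pos rfl)))
    ((hA.inner_xi _).trans (hA.eta_phi _)) he hw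
  refine ⟨h.1, h.2.1.trans ?_, h.2.2.trans ?_⟩
  · exact exists_congr fun e' ↦ exists_congr fun ν ↦ (isChenFrame_iff p _ e' ν).symm
  · exact exists_congr fun e' ↦ exists_congr fun ν ↦
      and_congr_left' (isChenFrame_iff p _ e' ν).symm

end ChenInequality

end

theorem mainTheorem1 {n m : ℕ} (hn : 3 ≤ n)
    {N : Type*} [TopologicalSpace N] [ChartedSpace (EuclideanSpace ℝ (Fin (2 * m + 1))) N]
    [IsManifold (𝓡 (2 * m + 1)) ∞ N]
    (S : AlmostContactMetric (EuclideanSpace ℝ (Fin (2 * m + 1))) N) (hS : S.IsContact)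
    (f₁ f₂ f₃ f₄ f₅₁ f₅₂ f₆ : N → ℝ)
    (hf : S.IsGeneralizedKappaMuDivided f₁ f₂ f₃ f₄ f₅₁ f₅₂ f₆)
    {M : Type*} [TopologicalSpace M] [ChartedSpace (EuclideanSpace ℝ (Fin n)) M]
    [IsManifold (𝓡 n) ∞ M]
    (g : SmoothMetric (EuclideanSpace ℝ (Fin n)) M) (F : M → N)
    (hF : IsIsometricImmersion g S.metric F)
    (hC : IsCTotallyReal (E := EuclideanSpace ℝ (Fin n)) S F)
    (p : M) (e : Fin n → TangentSpace (𝓡 n) p) (he : g.IsOrthonormal p e)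
    (P : Submodule ℝ (TangentSpace (𝓡 n) p))
    (w : Fin 2 → TangentSpace (𝓡 n) p) (hw : g.IsOrthonormal p w)
    (hP : Submodule.span ℝ (Set.range w) = P) :
    g.scalar p e - g.sectional p (w 0) (w 1) ≤ chenBound S f₁ f₄ f₅₁ f₅₂ g F p e w ∧
    (g.scalar p e - g.sectional p (w 0) (w 1) = chenBound S f₁ f₄ f₅₁ f₅₂ g F p e w ↔
      ∃ e' ν, IsChenFrame g S.metric F p P e' ν) ∧
    (g.scalar p e - g.sectional p (w 0) (w 1) = chenBound S f₁ f₄ f₅₁ f₅₂ g F p e w ∧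
        S.metric.inner (F p) (meanCurvature g S.metric F p e) (S.xi (F p)) = 0 ↔
      ∃ e' ν, IsChenFrame g S.metric F p P e' ν ∧
        ∀ r : Fin (2 * m + 1 - n), (r : ℕ) + 1 = 2 * m + 1 - n → ν r = S.xi (F p)) := by
  subst hP
  obtain ⟨k, rfl⟩ : ∃ k, n = k + 2 := ⟨n - 2, by omega⟩
  have hb := hF.chenBound_sub (by omega) hS hf hC p he hw
  obtain ⟨h1, h2, h3⟩ := chen_form_immersion hS hF hC p he hw
  rw [← hb] at h1 h2 h3
  have heq : g.scalar p e - g.sectional p (w 0) (w 1) = chenBound S f₁ f₄ f₅₁ f₅₂ g F p e w ↔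
      chenBound S f₁ f₄ f₅₁ f₅₂ g F p e w - (g.scalar p e - g.sectional p (w 0) (w 1)) = 0 := by
    rw [sub_eq_zero, eq_comm]
  -- `H` and `tr σ` differ by the nonzero factor `1 / n`, so they are orthogonal to `ξ`
  -- simultaneously.
  have hH : S.metric.inner (F p) (meanCurvature g S.metric F p e) (S.xi (F p)) = 0 ↔
      S.metric.form (F p) (∑ i, secondForm g S.metric F p (e i) (e i)) (S.xi (F p)) = 0 := by
    rw [inner_meanCurvature g S.metric F p e (S.xi (F p)), mul_eq_zero,
      or_iff_right (by positivity)]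
  rw [heq, hH]
  exact ⟨sub_nonneg.1 h1, h2, h3⟩
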